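/- Let $\Lambda$ be a regular local ring with $\dim \Lambda = 2$, and let $\mathcal{R}$ be a commutative ring containing $\Lambda$ such that $\mathcal{R}$ is free of finite rank over $\Lambda$ and $\operatorname{Hom}_\Lambda(\mathcal{R}, \Lambda) \simeq \mathcal{R}$ as $\mathcal{R}$-modules. Suppose that $\mathcal{R}$ is isomorphic to a finite product of regular local rings. Then for every finitely generated torsion $\mathcal{R}$-module $M$ (torsion meaning that each element is killed by a non-zero-divisor of $\mathcal{R}$), $$\operatorname{Fitt}_{\mathcal{R}}(M) = \operatorname{char}_{\mathcal{R}}(M)\cdot \operatorname{Fitt}_{\mathcal{R}}(E^2(M)).$$ Here $E^2(M) = \operatorname{Ext}^2_{\mathcal{R}}(M, \mathcal{R})$; $\operatorname{Fitt}_{\mathcal{R}}(N)$ is the initial Fitting ideal of a finitely generated module $N$, generated by the $b \times b$ minors of the matrix $H$ in any finite presentation $\mathcal{R}^a \xrightarrow{H} \mathcal{R}^b \to N \to 0$; and $\operatorname{char}_{\mathcal{R}}(M) = \prod_{\mathfrak{p}} \mathfrak{p}^{\operatorname{length}_{\mathcal{R}_{\mathfrak{p}}}(M_{\mathfrak{p}})}$,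 with $\mathfrak{p}$ running over the height one primes of $\mathcal{R}$, is the characteristic ideal of $M$. -/

import Mathlib

universe u v

/-- `A^a → A^b → M → 0` is a finite presentation of `M`: the map `π` is surjective, and its kernel
is the image of the map `x ↦ x * H` given by the `a × b` matrix `H`, that is, the span of the rows
of `H`. -/
def IsFinitePresentation {A : Type u} [CommRing A] {M : Type v} [AddCommGroup M] [Module A M]
    {a b : ℕ} (H : Matrix (Fin a) (Fin b) A) (π : (Fin b → A) →ₗ[A] M) : Prop :=
  Function.Exact H.vecMulLinear π ∧ Function.Surjective π

/-- The ideal generated by the `b × b` minors of an `a × b` matrix. (Rows are picked by an arbitrary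
function; a repeated row gives determinant `0` and a change of their order only a sign.) -/
def maximalMinorsIdeal {A : Type u} [CommRing A] {a b : ℕ} (H : Matrix (Fin a) (Fin b) A) :
    Ideal A :=
  Ideal.span (Set.range fun f : Fin b → Fin a => (H.submatrix f id).det)

/-- The (initial) Fitting ideal of a finitely presented module: the ideal generated by the
maximal minors of the matrix of a finite presentation. All finite presentations give the same ideal
(`fittingIdeal_eq_maximalMinorsIdeal`), so the supremum below is over equal ideals. -/
def fittingIdeal (A : Type u) [CommRing A] (M : Type v) [AddCommGroup M] [Module A M] : Ideal A :=
  ⨆ (a : ℕ) (b : ℕ) (H : Matrix (Fin a) (Fin b) A) (π : (Fin b → A) →ₗ[A] M)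
    (_ : IsFinitePresentation H π), maximalMinorsIdeal H

theorem det_mem_maximalMinorsIdeal {A : Type u} [CommRing A] {M : Type v} [AddCommGroup M]
    [Module A M] {a b : ℕ} {H : Matrix (Fin a) (Fin b) A} {π : (Fin b → A) →ₗ[A] M}
    (h : IsFinitePresentation H π) (N : Matrix (Fin b) (Fin b) A) (hN : ∀ i, π (N i) = 0) :
    N.det ∈ maximalMinorsIdeal H := by
  choose C hC using fun i => (h.1 (N i)).1 (hN i)
  have hrow : N = fun i => ∑ k, C i k • H k := by
    funext i
    rw [← hC i, Matrix.vecMulLinear_apply, Matrix.vecMul_eq_sum]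
  have := (Matrix.detRowAlternating (n := Fin b) (R := A)).toMultilinearMap.map_sum
    (fun i k => C i k • H k)
  have h2 : N.det = ∑ r : Fin b → Fin a, (∏ i, C i (r i)) * (H.submatrix r id).det := by
    rw [hrow]
    refine this.trans (Finset.sum_congr rfl fun r _ => ?_)
    rw [MultilinearMap.map_smul_univ]
    rfl
  rw [h2]
  exact Ideal.sum_mem _ fun r _ => Ideal.mul_mem_left _ _ (Ideal.subset_span ⟨r, rfl⟩)

theorem det_mem_maximalMinorsIdeal_of_castAdd {A : Type u} [CommRing A] {M : Type v}
    [AddCommGroup M] [Module A M] {a b : ℕ} {H : Matrix (Fin a) (Fin b) A}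
    {π : (Fin b → A) →ₗ[A] M} (h : IsFinitePresentation H π) (n : ℕ)
    (N : Matrix (Fin (b + n)) (Fin (b + n)) A)
    (hN : ∀ i, π (fun j => N i (Fin.castAdd n j)) = 0) : N.det ∈ maximalMinorsIdeal H := by
  induction n with
  | zero => exact det_mem_maximalMinorsIdeal h N hN
  | succ n ih =>
    have e := Matrix.det_succ_column (n := b + n) N (Fin.last _)
    refine e ▸ Ideal.sum_mem _ fun i _ => Ideal.mul_mem_left _ _ (ih _ fun k => ?_)
    have := hN (i.succAbove k)
    convert this using 3 with j
    simp [Matrix.submatrix_apply, Fin.succAbove_last]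
    rfl

theorem maximalMinorsIdeal_le {A : Type u} [CommRing A] {M : Type v} [AddCommGroup M]
    [Module A M] {a b a' b' : ℕ} {H : Matrix (Fin a) (Fin b) A} {π : (Fin b → A) →ₗ[A] M}
    (h : IsFinitePresentation H π) {H' : Matrix (Fin a') (Fin b') A}
    {π' : (Fin b' → A) →ₗ[A] M} (h' : IsFinitePresentation H' π') :
    maximalMinorsIdeal H' ≤ maximalMinorsIdeal H := by
  refine Ideal.span_le.2 ?_
  rintro _ ⟨f, rfl⟩
  choose C hC using fun i : Fin b' => h.2 (π' (Pi.single i 1))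
  choose E hE using fun i : Fin b => h'.2 (π (Pi.single i 1))
  have hC' : ∀ x : Fin b' → A, π (Matrix.vecMul x (Matrix.of C)) = π' x := by
    intro x
    rw [Matrix.vecMul_eq_sum, map_sum]
    conv_rhs => rw [pi_eq_sum_univ' x, map_sum]
    refine Finset.sum_congr rfl fun i _ => ?_
    rw [map_smul, map_smul]
    congr 1
    exact (hC i).trans (congrArg π' (by ext j; simp [Pi.single_apply, eq_comm]))
  have hH' : ∀ i, π' (H' i) = 0 := fun i =>
    (h'.1 (H' i)).2 ⟨Pi.single i 1, by simp [Matrix.row]⟩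
  set N' : Matrix (Fin b') (Fin b') A := H'.submatrix f id with hN'
  have hrow : ∀ i, π' (N' i) = 0 := fun i => hH' (f i)
  set Em : Matrix (Fin b) (Fin b') A := Matrix.of E
  set Cm : Matrix (Fin b') (Fin b) A := Matrix.of C
  have hdet : (Matrix.fromBlocks (1 - Em * Cm) (-Em) (N' * Cm) N').det = N'.det := by
    have : Matrix.fromBlocks (1 - Em * Cm) (-Em) (N' * Cm) N' =
        Matrix.fromBlocks 1 (-Em) 0 N' * Matrix.fromBlocks 1 0 Cm 1 := by
      rw [Matrix.fromBlocks_multiply]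
      simp [sub_eq_add_neg]
    rw [this, Matrix.det_mul, Matrix.det_fromBlocks_zero₂₁, Matrix.det_fromBlocks_zero₁₂]
    simp
  change N'.det ∈ maximalMinorsIdeal H
  rw [← hdet, ← Matrix.det_reindex_self (finSumFinEquiv (m := b) (n := b'))]
  refine det_mem_maximalMinorsIdeal_of_castAdd h b' _ fun i => ?_
  obtain ⟨i, rfl⟩ := finSumFinEquiv.surjective i
  rcases i with i | i
  · have e : (fun j => (Matrix.reindex finSumFinEquiv finSumFinEquiv
        (Matrix.fromBlocks (1 - Em * Cm) (-Em) (N' * Cm) N')) (finSumFinEquiv (Sum.inl i))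
        (Fin.castAdd b' j)) = Pi.single i 1 - Matrix.vecMul (E i) Cm := by
      funext j
      simp [Matrix.sub_apply, Matrix.one_apply, Pi.single_apply, eq_comm, Em,
        Matrix.mul_apply, Matrix.vecMul, dotProduct]
    rw [e, map_sub, hC', hE, sub_self]
  · have e : (fun j => (Matrix.reindex finSumFinEquiv finSumFinEquiv
        (Matrix.fromBlocks (1 - Em * Cm) (-Em) (N' * Cm) N')) (finSumFinEquiv (Sum.inr i))
        (Fin.castAdd b' j)) = Matrix.vecMul (N' i) Cm := by
      funext j
      simp [Matrix.mul_apply, Matrix.vecMul, dotProduct]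
    rw [e, hC', hrow]

theorem fittingIdeal_eq_maximalMinorsIdeal {A : Type u} [CommRing A] {M : Type v}
    [AddCommGroup M] [Module A M] {a b : ℕ} {H : Matrix (Fin a) (Fin b) A}
    {π : (Fin b → A) →ₗ[A] M} (h : IsFinitePresentation H π) :
    fittingIdeal A M = maximalMinorsIdeal H := by
  refine le_antisymm ?_ ?_
  · exact iSup_le fun _ => iSup_le fun _ => iSup_le fun _ => iSup_le fun _ => iSup_le fun h' =>
      maximalMinorsIdeal_le h h'
  · exact le_iSup_of_le a <| le_iSup_of_le b <| le_iSup_of_le H <| le_iSup_of_le π <|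
      le_iSup_of_le h le_rfl

/-- The ring is isomorphic to a finite product of regular local rings. -/
def IsProductOfRegularLocalRings (A : Type u) [CommRing A] : Prop :=
  ∃ (ι : Type) (_ : Finite ι) (B : ι → Type u) (_ : ∀ i, CommRing (B i)),
    (∀ i, IsRegularLocalRing (B i)) ∧ Nonempty (A ≃+* (∀ i, B i))

/-- The characteristic ideal of a finitely generated torsion module `M`: the product of `𝔭 ^ n(𝔭)`
over the height one primes `𝔭`, where `n(𝔭)` is the length of `M_𝔭` over `A_𝔭`. If `M` is
pseudo-isomorphic to a direct sum of modules `A ⧸ 𝔭ᵢ ^ eᵢ` with `𝔭ᵢ` of height one, then `n(𝔭)` is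
the sum of the `eᵢ` with `𝔭ᵢ = 𝔭`, and the ideal is the product of the `𝔭ᵢ ^ eᵢ`. Over a finite
product of regular local rings and for finitely generated torsion `M`, all `n(𝔭)` are finite and
only finitely many are nonzero. -/
noncomputable def characteristicIdeal (A : Type u) [CommRing A] (M : Type v) [AddCommGroup M]
    [Module A M] : Ideal A :=
  ∏ᶠ p : {p : PrimeSpectrum A // p.asIdeal.height = 1},
    p.1.asIdeal ^ (Module.length (Localization.AtPrime p.1.asIdeal)
      (LocalizedModule p.1.asIdeal.primeCompl M)).toNat

/-- `E^i(M) = Ext^i_A(M, A)`, with its natural `A`-module structure. -/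
abbrev extDual (A : Type u) [CommRing A] (M : Type u) [AddCommGroup M] [Module A M] (i : ℕ) :
    Type u :=
  CategoryTheory.Abelian.Ext (ModuleCat.of A M) (ModuleCat.of A A) i

/-! Every localization of `R` at a maximal ideal is regular local of dimension two, hence a
factorial domain over which second syzygies are free. The ring `R` is semilocal, so a presentation
`H` of `M` with `n` relations and `m` generators extends to an exact sequence `0 → R^(n-m) → R^n →
R^m → M → 0`, with first map `ψ` (`nonempty_basis_ker_vecMulLinear`). Dualizing, `E²(M)` is the
cokernel of the transpose of `ψ`, so both Fitting ideals are ideals of maximal minors, of `H` and of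
`ψ.transpose` (`exists_isFinitePresentation_extDual_two`).

As in the Hilbert–Burch theorem, complementary minors of `H` and `ψ` are proportional. If `d` kills
`M` and `Q * H = d`, then `β * Fitt(M) = d^m * Fitt(E²(M))`, where `β` is the determinant of `Q`
stacked on `ψ` (`span_det_mul_maximalMinorsIdeal_eq`).

The ratio of `d^m` to `β` is identified in height one. There the local ring is a principal ideal
domain, `ψ` splits, `Fitt(E²(M))` becomes the unit ideal, and `Fitt(M)` becomes the power of `p`
given by the length, which is also the localization of `char(M)`. In the factorial domain `R_P` this
determines the ratio up to a unit, and `β` can be cancelled (`eq_mul_of_forall_height_eq_one`). -/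

/-! ### Regular local rings of dimension two: domain, factoriality, free second syzygies. -/

open IsLocalRing in
/-- In a Noetherian local ring, a nonunit `x` generating a proper ideal whose quotient has positive
dimension and principal maximal ideal is prime. -/
theorem isDomain_of_maximalIdeal_eq_span_singleton {A : Type u} [CommRing A] [IsLocalRing A]
    [IsNoetherianRing A] {y : A} (hy : maximalIdeal A = Ideal.span {y})
    (hdim : ringKrullDim A ≠ 0) : IsDomain A := by
  obtain ⟨q, hq, hqm⟩ : ∃ q : Ideal A, q.IsPrime ∧ q ≠ maximalIdeal A := by
    by_contra! h
    refine hdim (ringKrullDimZero_iff_ringKrullDim_eq_zero.1 ?_)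
    exact Ring.krullDimLE_zero_iff.2 fun I hI => (h I hI) ▸ inferInstance
  have hyq : y ∉ q := fun h => hqm <| le_antisymm (le_maximalIdeal hq.ne_top) <| by
    rw [hy, Ideal.span_singleton_le_iff_mem]; exact h
  -- Since `y ∉ q` and `q ⊆ (y)`, primality gives `q = y q`, and Nakayama forces `q = 0`.
  have hle : q ≤ maximalIdeal A • q := fun z hz => by
    have hz' : z ∈ Ideal.span {y} := hy ▸ le_maximalIdeal hq.ne_top hz
    obtain ⟨w, rfl⟩ := Ideal.mem_span_singleton'.1 hz'
    rw [mul_comm]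
    exact Ideal.mul_mem_mul (hy ▸ Ideal.mem_span_singleton_self y)
      ((hq.mem_or_mem hz).resolve_right hyq)
  have hbot : q = ⊥ := Submodule.eq_bot_of_le_smul_of_le_jacobson_bot _ _
    (IsNoetherian.noetherian q) hle (maximalIdeal_le_jacobson _)
  subst hbot
  exact IsDomain.of_bot_isPrime A

open IsLocalRing Pointwise in
/-- A regular local ring of dimension two has a prime element `x` in its maximal ideal, outside all
minimal primes, such that the quotient by `x` is a domain with principal ideals. -/
theorem IsRegularLocalRing.exists_isPrincipalIdealRing_quotient (A : Type u) [CommRing A]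
    [IsRegularLocalRing A] (hdim : ringKrullDim A = 2) :
    ∃ x ∈ maximalIdeal A, (∀ p ∈ minimalPrimes A, x ∉ p) ∧ (Ideal.span {x}).IsPrime ∧
      IsPrincipalIdealRing (A ⧸ Ideal.span {x}) := by
  classical
  have hrank : (maximalIdeal A).spanFinrank = 2 := by
    have := IsRegularLocalRing.spanFinrank_maximalIdeal (R := A)
    rw [hdim] at this
    exact_mod_cast this
  obtain ⟨s, hcard, hspan⟩ := Submodule.FG.exists_span_finset_card_eq_spanFinrank
    (IsNoetherian.noetherian (maximalIdeal A))
  rw [hrank, Finset.card_eq_two] at hcard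
  obtain ⟨x, y, -, hs⟩ := hcard
  have hm : maximalIdeal A = Ideal.span {x, y} := by
    rw [← hspan, hs]; simp [Ideal.span]
  have hheight : (maximalIdeal A).height = 2 := by
    have := maximalIdeal_height_eq_ringKrullDim (R := A)
    rw [hdim] at this
    exact WithBot.coe_injective this
  have hxm : x ∈ maximalIdeal A := hm ▸ Ideal.subset_span (by simp)
  have hym : y ∈ maximalIdeal A := hm ▸ Ideal.subset_span (by simp)
  -- Prime avoidance by pigeonhole: a minimal prime containing `x + y^(j+1)` for two values of `j`
  -- contains `y`, because `1 - y^(k-j)` is a unit, hence also `x`. It would then be the maximal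
  -- ideal, of height two. So finitely many minimal primes cannot meet all these elements.
  have key : ∀ p ∈ minimalPrimes A, ∀ j k : ℕ, j < k → x + y ^ (j + 1) ∈ p →
      x + y ^ (k + 1) ∈ p → False := by
    intro p hp j k hjk hj hk
    have hpp : p.IsPrime := hp.1.1
    have h1 : y ^ (j + 1) * (1 - y ^ (k - j)) ∈ p := by
      have := p.sub_mem hj hk
      have e : k + 1 = (j + 1) + (k - j) := by omega
      rw [e, pow_add] at this
      convert this using 1; ring
    have h2 : y ∈ p := by
      refine (hpp.mem_or_mem h1).elim (fun h => hpp.mem_of_pow_mem _ h) fun h => ?_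
      refine absurd (Ideal.eq_top_of_isUnit_mem _ h ?_) hpp.ne_top
      exact isUnit_one_sub_self_of_mem_nonunits _
        (Ideal.pow_mem_of_mem _ hym _ (by omega))
    have h3 : x ∈ p := by
      have := p.sub_mem hj (Ideal.pow_mem_of_mem p h2 (j + 1) (by omega))
      simpa using this
    have h4 : p = maximalIdeal A := le_antisymm (le_maximalIdeal hpp.ne_top) <| by
      rw [hm, Ideal.span_le]
      rintro _ (rfl | rfl)
      exacts [h3, h2]
    have h5 : p.height = 0 := by
      exact Ideal.height_eq_zero_iff.2 hp
    rw [h4, hheight] at h5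
    exact absurd h5 (by norm_num)
  obtain ⟨k, hk⟩ : ∃ k : ℕ, ∀ p ∈ minimalPrimes A, x + y ^ (k + 1) ∉ p := by
    by_contra! h
    choose f hf hf' using h
    have hinj : Function.Injective fun k => (⟨f k, hf k⟩ : minimalPrimes A) := by
      intro j k hjk
      have e : f j = f k := congrArg Subtype.val hjk
      by_contra hne
      rcases lt_or_gt_of_ne hne with h | h
      · exact key _ (hf j) _ _ h (hf' j) (e ▸ hf' k)
      · exact key _ (hf k) _ _ h (hf' k) (e ▸ hf' j)
    have := (minimalPrimes.finite_of_isNoetherianRing A).to_subtype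
    exact not_injective_infinite_finite _ hinj
  set z := x + y ^ (k + 1) with hz
  have hzm : z ∈ maximalIdeal A :=
    Ideal.add_mem _ hxm (Ideal.pow_mem_of_mem _ hym _ (by omega))
  have : Nontrivial (A ⧸ Ideal.span {z}) := Ideal.Quotient.nontrivial_iff.2 fun h =>
    (maximalIdeal.isMaximal A).ne_top <| top_le_iff.1 <| h ▸ by
      rwa [Ideal.span_singleton_le_iff_mem]
  have : IsLocalRing (A ⧸ Ideal.span {z}) :=
    .of_surjective' (Ideal.Quotient.mk _) Ideal.Quotient.mk_surjective
  -- Modulo `z` one has `x = -y^(k+1)`, so `y` alone generates the maximal ideal.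
  have hmax : maximalIdeal (A ⧸ Ideal.span {z}) = Ideal.span {Ideal.Quotient.mk _ y} := by
    have hloc := IsLocalRing.map_maximalIdeal_of_surjective (Ideal.Quotient.mk (Ideal.span {z}))
      Ideal.Quotient.mk_surjective
    rw [← hloc, hm, Ideal.map_span, Set.image_pair]
    refine le_antisymm ?_ (Ideal.span_mono (by simp))
    rw [Ideal.span_le]
    rintro _ (rfl | rfl)
    · have : Ideal.Quotient.mk (Ideal.span {z}) x =
          - Ideal.Quotient.mk (Ideal.span {z}) y ^ (k + 1) := by
        rw [eq_neg_iff_add_eq_zero, ← map_pow, ← map_add, ← hz,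
          Ideal.Quotient.eq_zero_iff_mem]
        exact Ideal.mem_span_singleton_self z
      rw [this]
      exact neg_mem (Ideal.pow_mem_of_mem _ (Ideal.mem_span_singleton_self _) _ (by omega))
    · exact Ideal.mem_span_singleton_self _
  -- Dividing by one element lowers the dimension by at most one.
  have hdim' : ringKrullDim (A ⧸ Ideal.span {z}) ≠ 0 := by
    intro h
    have h1 := ringKrullDim_le_ringKrullDim_quotSMulTop_succ hzm
    have e : z • (⊤ : Submodule A A) = Ideal.span {z} := by
      simp [← Submodule.ideal_span_singleton_smul]
    rw [e, h, hdim] at h1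
    exact absurd h1 (by decide)
  have hdom := isDomain_of_maximalIdeal_eq_span_singleton hmax hdim'
  refine ⟨z, hzm, hk, (Ideal.Quotient.isDomain_iff_prime _).1 hdom, ?_⟩
  exact ((tfae_of_isNoetherianRing_of_isLocalRing_of_isDomain (A ⧸ Ideal.span {z})).out 4 0).1
    (⟨⟨_, hmax⟩⟩ : (maximalIdeal (A ⧸ Ideal.span {z})).IsPrincipal)

-- A minimal prime `q` inside `(x)` does not contain `x`, so `q = x q`, and Nakayama gives `q = 0`.
open IsLocalRing in
theorem IsRegularLocalRing.isDomain_of_ringKrullDim_eq_two (A : Type u) [CommRing A]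
    [IsRegularLocalRing A] (hdim : ringKrullDim A = 2) : IsDomain A := by
  obtain ⟨x, hxm, hx, hp, -⟩ := exists_isPrincipalIdealRing_quotient A hdim
  obtain ⟨q, hq, hqx⟩ := Ideal.exists_minimalPrimes_le (I := ⊥) (J := Ideal.span {x}) bot_le
  have hqp : q.IsPrime := hq.1.1
  have hle : q ≤ maximalIdeal A • q := fun z hz => by
    obtain ⟨w, rfl⟩ := Ideal.mem_span_singleton'.1 (hqx hz)
    rw [mul_comm]
    exact Ideal.mul_mem_mul hxm ((hqp.mem_or_mem hz).resolve_right (hx q hq))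
  have hbot : q = ⊥ := Submodule.eq_bot_of_le_smul_of_le_jacobson_bot _ _
    (IsNoetherian.noetherian q) hle (maximalIdeal_le_jacobson _)
  subst hbot
  exact IsDomain.of_bot_isPrime A

open IsLocalRing in
/-- A regular local ring of dimension two has a prime element `x` in its maximal ideal such that
the ideals of the quotient by `x` are principal. -/
theorem IsRegularLocalRing.exists_prime_isPrincipalIdealRing_quotient (A : Type u) [CommRing A]
    [IsRegularLocalRing A] (hdim : ringKrullDim A = 2) :
    ∃ x ∈ maximalIdeal A, Prime x ∧ IsPrincipalIdealRing (A ⧸ Ideal.span {x}) := by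
  obtain ⟨x, hxm, hx, hp, hpir⟩ := exists_isPrincipalIdealRing_quotient A hdim
  have := isDomain_of_ringKrullDim_eq_two A hdim
  refine ⟨x, hxm, (Ideal.span_singleton_prime ?_).1 hp, hpir⟩
  rintro rfl
  obtain ⟨p, hp⟩ := Ideal.nonempty_minimalPrimes (I := (⊥ : Ideal A)) bot_ne_top
  exact hx p hp p.zero_mem

-- By Kaplansky's criterion it suffices to find a prime element in each nonzero prime `p`. If `x ∉
-- p`, lift a generator of the image of `p` modulo `x` to `w ∈ p`. Any `z ∈ p` is `c w + x t`, and
-- `t ∈ p` since `x ∉ p`. Hence `p = (w) + x p`, and Nakayama gives `p = (w)`.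
open IsLocalRing in
theorem IsRegularLocalRing.uniqueFactorizationMonoid_of_ringKrullDim_eq_two (A : Type u)
    [CommRing A] [IsDomain A] [IsRegularLocalRing A] (hdim : ringKrullDim A = 2) :
    UniqueFactorizationMonoid A := by
  obtain ⟨x, hxm, hx, hpir⟩ := exists_prime_isPrincipalIdealRing_quotient A hdim
  refine UniqueFactorizationMonoid.iff_exists_prime_mem_of_isPrime.mpr fun p hp0 hp => ?_
  by_cases hxp : x ∈ p
  · exact ⟨x, hxp, hx⟩
  obtain ⟨a, ha⟩ := IsPrincipalIdealRing.principal (p.map (Ideal.Quotient.mk (Ideal.span {x})))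
  have hmem : a ∈ p.map (Ideal.Quotient.mk (Ideal.span {x})) :=
    ha ▸ Submodule.mem_span_singleton_self a
  obtain ⟨w, hwp, rfl⟩ := (Ideal.mem_map_iff_of_surjective _ Ideal.Quotient.mk_surjective).1 hmem
  have hle : p ≤ Ideal.span {w} ⊔ maximalIdeal A • p := by
    intro z hz
    have h1 := Ideal.mem_map_of_mem (Ideal.Quotient.mk (Ideal.span {x})) hz
    rw [ha] at h1
    obtain ⟨c, hc⟩ := Ideal.mem_span_singleton'.1 h1
    obtain ⟨c, rfl⟩ := Ideal.Quotient.mk_surjective c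
    rw [← map_mul, eq_comm, Ideal.Quotient.mk_eq_mk_iff_sub_mem] at hc
    obtain ⟨t, ht⟩ := Ideal.mem_span_singleton'.1 hc
    have htp : t ∈ p := by
      have : t * x ∈ p := ht ▸ p.sub_mem hz (p.mul_mem_left c hwp)
      exact (hp.mem_or_mem this).resolve_right hxp
    have : z = c * w + x * t := by linear_combination -ht
    rw [this]
    exact Submodule.add_mem_sup (Ideal.mem_span_singleton'.2 ⟨c, rfl⟩) (Ideal.mul_mem_mul hxm htp)
  have hpw : p ≤ Ideal.span {w} :=
    Submodule.le_of_le_smul_of_le_jacobson_bot (IsNoetherian.noetherian p)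
      (maximalIdeal_le_jacobson _) hle
  have hpw' : p = Ideal.span {w} :=
    le_antisymm hpw (by rwa [Ideal.span_singleton_le_iff_mem])
  refine ⟨w, hwp, (Ideal.span_singleton_prime ?_).1 (hpw' ▸ hp)⟩
  rintro rfl
  exact hp0 (by simpa using hpw')

open IsLocalRing Pointwise in
/-- Over a regular local ring of dimension two, second syzygy modules are free. -/
theorem IsRegularLocalRing.free_ker_of_ringKrullDim_eq_two {A : Type u} [CommRing A]
    [IsRegularLocalRing A] (hdim : ringKrullDim A = 2) {F G : Type*} [AddCommGroup F] [Module A F]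
    [AddCommGroup G] [Module A G] [Module.Free A F] [Module.Finite A F] [Module.Free A G]
    (f : F →ₗ[A] G) : Module.Free A (LinearMap.ker f) := by
  have := isDomain_of_ringKrullDim_eq_two A hdim
  obtain ⟨x, hxm, hx, hpir⟩ := exists_prime_isPrincipalIdealRing_quotient A hdim
  have hdom : IsDomain (A ⧸ Ideal.span {x}) :=
    (Ideal.Quotient.isDomain_iff_prime _).2 ((Ideal.span_singleton_prime hx.ne_zero).2 hx)
  have : Module.FinitePresentation A (LinearMap.ker f) :=
    Module.finitePresentation_of_finite A _
  have hreg : IsSMulRegular (LinearMap.ker f) x := fun a b hab =>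
    smul_right_injective _ hx.ne_zero hab
  -- As `x` is regular on the kernel `K` and lies in the Jacobson radical, freeness may be tested on
  -- `K/xK`. Over the principal ideal domain `A/x` this amounts to torsion-freeness.
  rw [← Module.free_quotSMulTop_iff_free A (LinearMap.ker f)
    (maximalIdeal_le_jacobson _ hxm) hreg]
  have : Module.Finite (A ⧸ Ideal.span {x}) (QuotSMulTop x (LinearMap.ker f)) :=
    Module.Finite.of_restrictScalars_finite A _ _
  suffices Module.IsTorsionFree (A ⧸ Ideal.span {x}) (QuotSMulTop x (LinearMap.ker f)) from
    Module.free_of_finite_type_torsion_free'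
  refine ⟨fun a ha => ?_⟩
  obtain ⟨a, rfl⟩ := Ideal.Quotient.mk_surjective a
  have hxa : ¬ x ∣ a := fun h => ha.ne_zero <|
    Ideal.Quotient.eq_zero_iff_mem.2 (Ideal.mem_span_singleton.2 h)
  refine isSMulRegular_iff_right_eq_zero_of_smul.2 fun u hu => ?_
  obtain ⟨k, rfl⟩ := Submodule.Quotient.mk_surjective _ u
  have h1 : a • k ∈ x • (⊤ : Submodule A (LinearMap.ker f)) :=
    (Submodule.Quotient.mk_eq_zero _).1 hu
  obtain ⟨w, -, hw⟩ := (Submodule.mem_smul_pointwise_iff_exists _ _ _).1 h1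
  have h2 : a • (k : F) = x • (w : F) := congrArg Subtype.val hw.symm
  let b := Module.Free.chooseBasis A F
  have h3 : ∀ i, ∃ c, b.repr k i = x * c := fun i => by
    refine (hx.dvd_or_dvd (a := a) ⟨b.repr w i, ?_⟩).resolve_left hxa
    simpa using congrArg (fun t => b.repr t i) h2
  choose c hc using h3
  have h4 : (k : F) = x • ∑ i, c i • b i := by
    conv_lhs => rw [← b.sum_repr k]
    simp only [hc, mul_smul, Finset.smul_sum]
  -- The quotient of `k` by `x`, formed in `F`, stays in the kernel because `G` has no `x`-torsion.
  have h5 : f (∑ i, c i • b i) = 0 := by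
    have : x • f (∑ i, c i • b i) = 0 := by rw [← map_smul, ← h4]; exact k.2
    exact (smul_eq_zero.1 this).resolve_left hx.ne_zero
  refine (Submodule.Quotient.mk_eq_zero _).2 <|
    (Submodule.mem_smul_pointwise_iff_exists _ _ _).2 ⟨⟨_, h5⟩, trivial, Subtype.ext h4.symm⟩

/-! ### The second Ext module as the cokernel of a transpose. -/

open CategoryTheory CategoryTheory.Abelian in
/-- If `0 → F₂ → F₁ → F₀ → M → 0` is exact with `F₁` and `F₀` projective, then `Ext²(M, A)` is the
cokernel of the transpose of `F₂ → F₁`. -/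
theorem exists_surjective_dual_extDual_two {A : Type u} [CommRing A] {F₂ F₁ F₀ M : Type u}
    [AddCommGroup F₂] [Module A F₂] [AddCommGroup F₁] [Module A F₁] [AddCommGroup F₀] [Module A F₀]
    [AddCommGroup M] [Module A M] [Module.Projective A F₁] [Module.Projective A F₀]
    {i : F₂ →ₗ[A] F₁} {h : F₁ →ₗ[A] F₀} {π : F₀ →ₗ[A] M} (hi : Function.Injective i)
    (hih : Function.Exact i h) (hhπ : Function.Exact h π) (hπ : Function.Surjective π) :
    ∃ θ : (F₂ →ₗ[A] A) →ₗ[A] extDual A M 2, Function.Surjective θ ∧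
      ∀ φ, θ φ = 0 ↔ ∃ g : F₁ →ₗ[A] A, g ∘ₗ i = φ := by
  let S₁ : ShortComplex (ModuleCat.{u} A) :=
    { X₁ := ModuleCat.of A F₂, X₂ := ModuleCat.of A F₁, X₃ := ModuleCat.of A (LinearMap.range h)
      f := ModuleCat.ofHom i, g := ModuleCat.ofHom h.rangeRestrict
      zero := by
        refine ModuleCat.hom_ext (LinearMap.ext fun x => Subtype.ext ?_)
        exact hih.apply_apply_eq_zero x }
  let S₂ : ShortComplex (ModuleCat.{u} A) :=
    { X₁ := ModuleCat.of A (LinearMap.range h), X₂ := ModuleCat.of A F₀, X₃ := ModuleCat.of A M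
      f := ModuleCat.ofHom (LinearMap.range h).subtype, g := ModuleCat.ofHom π
      zero := by
        ext ⟨_, x, rfl⟩
        exact hhπ.apply_apply_eq_zero x }
  have hS₁ : S₁.ShortExact :=
    { exact := (ShortComplex.moduleCat_exact_iff _).2 fun x hx =>
        (hih x).1 (congrArg Subtype.val hx)
      mono_f := (ModuleCat.mono_iff_injective _).2 hi
      epi_g := (ModuleCat.epi_iff_surjective _).2 h.surjective_rangeRestrict }
  have hS₂ : S₂.ShortExact :=
    { exact := (ShortComplex.moduleCat_exact_iff _).2 fun x hx => by
        obtain ⟨y, hy⟩ := (hhπ x).1 hx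
        exact ⟨⟨x, y, hy⟩, rfl⟩
      mono_f := (ModuleCat.mono_iff_injective _).2 Subtype.val_injective
      epi_g := (ModuleCat.epi_iff_surjective _).2 hπ }
  have hproj₁ : Projective S₁.X₂ := (IsProjective.iff_projective F₁).1 inferInstance
  have hproj₂ : Projective S₂.X₂ := (IsProjective.iff_projective F₀).1 inferInstance
  let Y := ModuleCat.of A A
  let θ₀ : (F₂ →ₗ[A] A) ≃ₗ[A] Ext S₁.X₁ Y 0 :=
    (ModuleCat.homLinearEquiv (S := A) (M := S₁.X₁) (N := Y)).symm ≪≫ₗ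
      (Ext.linearEquiv₀ (R := A)).symm
  -- Dimension shifting: `θ₁` and `θ₂` are the connecting maps of the two short exact sequences.
  -- Since `F₁` and `F₀` are projective, `θ₁` is surjective with kernel the image of `Hom(F₁, A)`,
  -- and `θ₂` is bijective.
  let θ₁ : Ext S₁.X₁ Y 0 →ₗ[A] Ext S₂.X₁ Y 1 :=
    Ext.bilinearCompOfLinear A S₁.X₃ S₁.X₁ Y 1 0 1 rfl hS₁.extClass
  let θ₂ : Ext S₂.X₁ Y 1 →ₗ[A] Ext S₂.X₃ Y 2 :=
    Ext.bilinearCompOfLinear A S₂.X₃ S₂.X₁ Y 1 1 2 rfl hS₂.extClass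
  have hθ₁ : Function.Surjective θ₁ := fun x => by
    obtain ⟨y, hy⟩ := Ext.contravariant_sequence_exact₃ hS₁ Y x
      (Ext.eq_zero_of_projective _) (n₀ := 0) rfl
    exact ⟨y, hy⟩
  have hθ₂ : Function.Surjective θ₂ := fun x => by
    obtain ⟨y, hy⟩ := Ext.contravariant_sequence_exact₃ hS₂ Y x
      (Ext.eq_zero_of_projective _) (n₀ := 1) rfl
    exact ⟨y, hy⟩
  have hθ₂' : Function.Injective θ₂ := (injective_iff_map_eq_zero _).2 fun x hx => by
    obtain ⟨y, rfl⟩ := Ext.contravariant_sequence_exact₁ hS₂ Y x rfl hx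
    rw [Ext.eq_zero_of_projective y, Ext.comp_zero]
  refine ⟨θ₂ ∘ₗ θ₁ ∘ₗ θ₀.toLinearMap, hθ₂.comp (hθ₁.comp θ₀.surjective), fun φ => ?_⟩
  have hcomp : ∀ g : F₁ →ₗ[A] A, (Ext.mk₀ S₁.f).comp (Ext.mk₀ (ModuleCat.ofHom g : S₁.X₂ ⟶ Y))
      (zero_add 0) = θ₀ (g ∘ₗ i) := fun g => by
    rw [Ext.mk₀_comp_mk₀]
    rfl
  rw [LinearMap.comp_apply, map_eq_zero_iff θ₂ hθ₂', LinearMap.comp_apply]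
  constructor
  · intro hφ
    obtain ⟨y, hy⟩ := Ext.contravariant_sequence_exact₁ hS₁ Y (θ₀ φ) rfl hφ
    obtain ⟨g, rfl⟩ := (Ext.mk₀_bijective S₁.X₂ Y).2 y
    refine ⟨g.hom, θ₀.injective ?_⟩
    rw [← hcomp, ← hy]
    rfl
  · rintro ⟨g, rfl⟩
    rw [LinearEquiv.coe_coe, ← hcomp, Ext.bilinearCompOfLinear_apply_apply,
      ShortComplex.ShortExact.extClass_comp_assoc]

theorem exists_isFinitePresentation_extDual_two {A : Type u} [CommRing A] {M : Type u}
    [AddCommGroup M] [Module A M] {s n m : ℕ} {ψ : Matrix (Fin s) (Fin n) A}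
    {H : Matrix (Fin n) (Fin m) A} {π : (Fin m → A) →ₗ[A] M} (hπ : IsFinitePresentation H π)
    (hψ : Function.Injective ψ.vecMulLinear)
    (hψH : Function.Exact ψ.vecMulLinear H.vecMulLinear) :
    ∃ ρ : (Fin s → A) →ₗ[A] extDual A M 2, IsFinitePresentation ψ.transpose ρ := by
  obtain ⟨θ, hθ, hθ'⟩ := exists_surjective_dual_extDual_two hψ hψH hπ.1 hπ.2
  let e : (k : ℕ) → (Fin k → A) ≃ₗ[A] ((Fin k → A) →ₗ[A] A) := fun k => dotProductEquiv A (Fin k)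
  refine ⟨θ ∘ₗ (e s).toLinearMap, fun v => ?_, hθ.comp (e s).surjective⟩
  refine (hθ' (e s v)).trans ⟨?_, ?_⟩
  · rintro ⟨g, hg⟩
    obtain ⟨w, rfl⟩ := (e n).surjective g
    refine ⟨w, (e s).injective ?_⟩
    rw [← hg]
    ext j
    simp [e, Matrix.mulVec, dotProduct_comm]
    rfl
  · rintro ⟨w, rfl⟩
    refine ⟨e n w, ?_⟩
    ext j
    simp [e, Matrix.mulVec, dotProduct_comm]
    rfl

/-! ### Proportionality of complementary minors. -/

/-- An injective map into a finite type extends to an equivalence, by a map of complementary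
cardinality. -/
theorem exists_sum_equiv_of_injective {ι κ ν : Type*} [Fintype ι] [Fintype κ] [Fintype ν]
    (hcard : Fintype.card ι + Fintype.card κ = Fintype.card ν) {f : ι → ν}
    (hf : Function.Injective f) : ∃ e : ι ⊕ κ ≃ ν, ∀ i, e (Sum.inl i) = f i := by
  classical
  have h : Fintype.card κ = Fintype.card ↥(Set.range f)ᶜ := by
    have := Fintype.card_compl_set (Set.range f)
    rw [Set.card_range_of_injective hf] at this
    omega
  refine ⟨((Equiv.ofInjective f hf).sumCongr (Fintype.equivOfCardEq h)).trans
    (Equiv.Set.sumCompl (Set.range f)), fun i => ?_⟩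
  simp

theorem Matrix.submatrix_inl_mul_add_submatrix_inr_mul {A ι κ ν μ τ : Type*} [CommRing A]
    [Fintype ι] [Fintype κ] [Fintype ν] (Q : Matrix μ ν A) (H : Matrix ν τ A) (e : ι ⊕ κ ≃ ν) :
    Q.submatrix id (e ∘ Sum.inl) * H.submatrix (e ∘ Sum.inl) id +
      Q.submatrix id (e ∘ Sum.inr) * H.submatrix (e ∘ Sum.inr) id = Q * H := by
  ext i j
  simp only [add_apply, mul_apply, submatrix_apply, id, Function.comp]
  rw [← e.sum_comp, Fintype.sum_sum_type]

/-- Multiply `P` stacked on `ψ` by the square matrix made of `H` and an identity block. The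
relations for `P * H` and `ψ * H` make the product block upper triangular with diagonal blocks `d •
1` and a minor of `ψ`; take determinants. -/
theorem Matrix.det_mul_det_submatrix_eq_pow_mul_det_submatrix {A ι κ ν : Type*} [CommRing A]
    [Fintype ι] [Fintype κ] [Fintype ν] [DecidableEq ι] [DecidableEq κ] {H : Matrix ν ι A}
    {P : Matrix ι ν A} {ψ : Matrix κ ν A} {d : A} (hP : P * H = d • 1) (hψ : ψ * H = 0)
    (e : ι ⊕ κ ≃ ν) :
    ((fromRows P ψ).submatrix id e).det * (H.submatrix (e ∘ Sum.inl) id).det =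
      d ^ Fintype.card ι * (ψ.submatrix id (e ∘ Sum.inr)).det := by
  have hmul : (fromRows P ψ).submatrix id e *
      fromBlocks (H.submatrix (e ∘ Sum.inl) id) 0 (H.submatrix (e ∘ Sum.inr) id) 1 =
      fromBlocks (d • 1) (P.submatrix id (e ∘ Sum.inr)) 0 (ψ.submatrix id (e ∘ Sum.inr)) := by
    have : (fromRows P ψ).submatrix id e = fromBlocks (P.submatrix id (e ∘ Sum.inl))
        (P.submatrix id (e ∘ Sum.inr)) (ψ.submatrix id (e ∘ Sum.inl))
        (ψ.submatrix id (e ∘ Sum.inr)) := by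
      ext (i | i) (j | j) <;> rfl
    rw [this, fromBlocks_multiply, submatrix_inl_mul_add_submatrix_inr_mul,
      submatrix_inl_mul_add_submatrix_inr_mul, hP, hψ]
    simp
  have := congrArg det hmul
  rw [det_mul, det_fromBlocks_zero₁₂, det_fromBlocks_zero₂₁, det_one, mul_one, det_smul,
    det_one, mul_one] at this
  exact this

theorem span_singleton_mul_maximalMinorsIdeal_le {A : Type u} [CommRing A] {a b : ℕ}
    {H : Matrix (Fin a) (Fin b) A} {c : A} {I : Ideal A}
    (h : ∀ f : Fin b → Fin a, Function.Injective f → c * (H.submatrix f id).det ∈ I) :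
    Ideal.span {c} * maximalMinorsIdeal H ≤ I := by
  rw [Ideal.span_singleton_mul_le_iff]
  intro z hz
  induction hz using Submodule.span_induction with
  | mem z hz =>
    obtain ⟨f, rfl⟩ := hz
    by_cases hf : Function.Injective f
    · exact h f hf
    · obtain ⟨i, j, hij, hne⟩ : ∃ i j, f i = f j ∧ i ≠ j := by
        simpa [Function.Injective] using hf
      have : (H.submatrix f id).det = 0 :=
        Matrix.det_zero_of_row_eq hne (by ext k; simp [hij])
      simp [this]
  | zero => simp
  | add x y _ _ hx hy => rw [mul_add]; exact I.add_mem hx hy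
  | smul r x _ hx => rw [smul_eq_mul, mul_left_comm]; exact I.mul_mem_left _ hx

/-- A choice of rows of `H` and the complementary choice of columns of `ψ` come from one bijection
`e'`. Replacing `e'` by the fixed `e` only changes the sign of the stacked determinant, so a single
factor serves all minors. -/
theorem span_det_mul_maximalMinorsIdeal_eq {A : Type u} [CommRing A] {s n m : ℕ}
    {ψ : Matrix (Fin s) (Fin n) A} {H : Matrix (Fin n) (Fin m) A} {P : Matrix (Fin m) (Fin n) A}
    {d : A} (hP : P * H = d • 1) (hψ : ψ * H = 0) (e : Fin m ⊕ Fin s ≃ Fin n) :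
    Ideal.span {((Matrix.fromRows P ψ).submatrix id e).det} * maximalMinorsIdeal H =
      Ideal.span {d ^ m} * maximalMinorsIdeal ψ.transpose := by
  have hcard : m + s = n := by simpa using Fintype.card_congr e
  have hsign : ∀ e' : Fin m ⊕ Fin s ≃ Fin n, ∃ u : Aˣ,
      ((Matrix.fromRows P ψ).submatrix id e).det =
        u * ((Matrix.fromRows P ψ).submatrix id e').det := by
    intro e'
    refine ⟨Units.map (Int.castRingHom A).toMonoidHom (Equiv.Perm.sign (e.trans e'.symm)), ?_⟩
    have := Matrix.det_permute' (e.trans e'.symm) ((Matrix.fromRows P ψ).submatrix id e')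
    rw [Matrix.submatrix_submatrix] at this
    convert this using 2
    · congr 1
      ext i
      simp
    · rfl
  have key : ∀ e' : Fin m ⊕ Fin s ≃ Fin n, ∃ u : Aˣ,
      ((Matrix.fromRows P ψ).submatrix id e).det * (H.submatrix (e' ∘ Sum.inl) id).det =
        u * (d ^ m * (ψ.transpose.submatrix (e' ∘ Sum.inr) id).det) := by
    intro e'
    obtain ⟨u, hu⟩ := hsign e'
    refine ⟨u, ?_⟩
    have := Matrix.det_mul_det_submatrix_eq_pow_mul_det_submatrix hP hψ e'
    rw [Fintype.card_fin] at this
    rw [hu, mul_assoc, this, ← Matrix.det_transpose (ψ.submatrix _ _)]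
    rfl
  refine le_antisymm (span_singleton_mul_maximalMinorsIdeal_le fun f hf => ?_)
    (span_singleton_mul_maximalMinorsIdeal_le fun g hg => ?_)
  · obtain ⟨e', he'⟩ := exists_sum_equiv_of_injective (κ := Fin s) (by simpa using hcard) hf
    obtain rfl : f = e' ∘ Sum.inl := funext fun i => (he' i).symm
    obtain ⟨u, hu⟩ := key e'
    rw [hu]
    exact Ideal.mul_mem_left _ _ (Ideal.mul_mem_mul (Ideal.mem_span_singleton_self _)
      (Ideal.subset_span ⟨_, rfl⟩))
  · obtain ⟨e', he'⟩ := exists_sum_equiv_of_injective (κ := Fin m)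
      (by simpa [add_comm] using hcard) hg
    obtain rfl : g = ((Equiv.sumComm _ _).trans e') ∘ Sum.inr := funext fun i => (he' i).symm
    obtain ⟨u, hu⟩ := key ((Equiv.sumComm _ _).trans e')
    rw [← Units.inv_mul_eq_iff_eq_mul] at hu
    rw [← hu]
    exact Ideal.mul_mem_left _ _ (Ideal.mul_mem_mul (Ideal.mem_span_singleton_self _)
      (Ideal.subset_span ⟨_, rfl⟩))

-- If `(x, y)` is a left kernel vector, multiplying by `H` kills the `ψ` part and leaves `d x = 0`.
-- Then `y ψ = 0`, and injectivity gives `y = 0`.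
open Matrix in
theorem Matrix.det_fromRows_submatrix_ne_zero {A ι κ ν : Type*} [CommRing A] [IsDomain A]
    [Fintype ι] [Fintype κ] [Fintype ν] [DecidableEq ι] [DecidableEq κ] {H : Matrix ν ι A}
    {P : Matrix ι ν A} {ψ : Matrix κ ν A} {d : A} (hd : d ≠ 0) (hP : P * H = d • 1)
    (hψ : ψ * H = 0) (hinj : ∀ y, y ᵥ* ψ = 0 → y = 0) (e : ι ⊕ κ ≃ ν) :
    ((fromRows P ψ).submatrix id e).det ≠ 0 := by
  intro h0
  obtain ⟨v, hv0, hv⟩ := exists_vecMul_eq_zero_iff.2 h0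
  have hv' : v ᵥ* fromRows P ψ = 0 := by
    ext j
    simpa [vecMul, dotProduct] using congrFun hv (e.symm j)
  obtain ⟨x, y, rfl⟩ : ∃ x y, v = Sum.elim x y := ⟨_, _, (Sum.elim_comp_inl_inr v).symm⟩
  rw [vecMul_fromRows, Sum.elim_comp_inl, Sum.elim_comp_inr] at hv'
  have hx : x = 0 := by
    have := congrArg (· ᵥ* H) hv'
    simp only [add_vecMul, vecMul_vecMul, hP, hψ, vecMul_zero, add_zero, zero_vecMul,
      vecMul_smul, vecMul_one] at this
    exact (smul_eq_zero.1 this).resolve_left hd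
  subst hx
  rw [zero_vecMul, zero_add] at hv'
  exact hv0 (by rw [hinj y hv']; ext (i | i) <;> rfl)

/-! ### Fitting ideals over principal ideal domains and under localization. -/

theorem maximalMinorsIdeal_eq_span_det {A : Type u} [CommRing A] {b : ℕ}
    (D : Matrix (Fin b) (Fin b) A) : maximalMinorsIdeal D = Ideal.span {D.det} := by
  refine le_antisymm (Ideal.span_le.2 ?_) (Ideal.span_mono ?_)
  · rintro _ ⟨f, rfl⟩
    have : D.submatrix f id = (1 : Matrix (Fin b) (Fin b) A).submatrix f id * D := by
      ext i j
      simp [Matrix.mul_apply, Matrix.one_apply]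
    simp only [this, Matrix.det_mul]
    exact Ideal.mul_mem_left _ _ (Ideal.mem_span_singleton_self _)
  · rintro _ rfl
    exact ⟨id, by simp⟩

theorem maximalMinorsIdeal_map {A B : Type*} [CommRing A] [CommRing B] (φ : A →+* B) {a b : ℕ}
    (H : Matrix (Fin a) (Fin b) A) :
    maximalMinorsIdeal (H.map φ) = (maximalMinorsIdeal H).map φ := by
  rw [maximalMinorsIdeal, maximalMinorsIdeal, Ideal.map_span, ← Set.range_comp]
  congr 2
  ext f
  simp [RingHom.map_det, Matrix.submatrix_map]

open IsLocalRing in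
/-- Over a local ring with principal ideals, the Fitting ideal of a finitely generated torsion
module is the power of the maximal ideal given by the length. -/
theorem fittingIdeal_eq_maximalIdeal_pow_length {A : Type u} [CommRing A] [IsDomain A]
    [IsLocalRing A] [IsPrincipalIdealRing A] {M : Type v} [AddCommGroup M] [Module A M]
    [Module.Finite A M] (htors : Module.IsTorsion A M) :
    fittingIdeal A M = maximalIdeal A ^ (Module.length A M).toNat := by
  classical
  obtain ⟨ι, _, p, hp, k, ⟨e⟩⟩ := Module.equiv_directSum_of_isTorsion htors
  let e' : M ≃ₗ[A] Π i, A ⧸ Ideal.span {p i ^ k i} :=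
    e.trans (DirectSum.linearEquivFunOnFintype A ι fun i => A ⧸ Ideal.span {p i ^ k i})
  have hlen : Module.length A M = ((∑ i, k i : ℕ) : ℕ∞) := by
    rw [e'.length_eq, Module.length_pi_of_fintype]
    push_cast
    refine Finset.sum_congr rfl fun i _ => ?_
    change Ring.ord A (p i ^ k i) = _
    rw [Ring.ord_pow (mem_nonZeroDivisors_of_ne_zero (hp i).ne_zero),
      Ring.ord_of_irreducible (hp i)]
    simp
  let q := Fintype.equivFin ι
  -- The structure theorem yields a square diagonal presentation; its determinant is the product of
  -- the prime powers, whose exponents add up to the length.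
  let D : Matrix (Fin (Fintype.card ι)) (Fin (Fintype.card ι)) A :=
    Matrix.diagonal fun j => p (q.symm j) ^ k (q.symm j)
  let π₀ : (Fin (Fintype.card ι) → A) →ₗ[A] Π i, A ⧸ Ideal.span {p i ^ k i} :=
    LinearMap.pi fun i => (Ideal.span {p i ^ k i}).mkQ ∘ₗ LinearMap.proj (q i)
  have hπ : IsFinitePresentation D (e'.symm.toLinearMap ∘ₗ π₀) := by
    constructor
    · intro x
      change e'.symm (π₀ x) = 0 ↔ _
      rw [map_eq_zero_iff _ e'.symm.injective, funext_iff]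
      simp only [π₀, LinearMap.pi_apply, LinearMap.comp_apply, LinearMap.proj_apply,
        Submodule.mkQ_apply, Pi.zero_apply, Submodule.Quotient.mk_eq_zero,
        Ideal.mem_span_singleton']
      constructor
      · intro h
        choose c hc using h
        refine ⟨fun j => c (q.symm j), funext fun j => ?_⟩
        rw [Matrix.vecMulLinear_apply, Matrix.vecMul_diagonal, hc, q.apply_symm_apply]
      · rintro ⟨c, rfl⟩ i
        refine ⟨c (q i), ?_⟩
        rw [Matrix.vecMulLinear_apply, Matrix.vecMul_diagonal, q.symm_apply_apply]
    · refine e'.symm.surjective.comp fun y => ?_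
      choose c hc using fun i => Submodule.mkQ_surjective _ (y i)
      refine ⟨fun j => c (q.symm j), funext fun i => ?_⟩
      simpa [π₀] using hc i
  rw [fittingIdeal_eq_maximalMinorsIdeal hπ, maximalMinorsIdeal_eq_span_det, Matrix.det_diagonal,
    q.symm.prod_comp fun i => p i ^ k i, hlen, ← Ideal.prod_span_singleton, ENat.toNat_natCast,
    ← Finset.prod_pow_eq_pow_sum]
  refine Finset.prod_congr rfl fun i _ => ?_
  have hmax : Ideal.span {p i} = maximalIdeal A :=
    eq_maximalIdeal (PrincipalIdealRing.isMaximal_of_irreducible (hp i))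
  rw [← Ideal.span_singleton_pow, hmax]

/-- The image of `H` is a submodule of a free module over a principal ideal domain, hence
projective. So `ψ` has a retraction, its transpose is surjective and presents the zero module, for
which `1` is an admissible determinant. -/
theorem maximalMinorsIdeal_transpose_eq_top {A : Type u} [CommRing A] [IsDomain A]
    [IsPrincipalIdealRing A] {s n m : ℕ} {ψ : Matrix (Fin s) (Fin n) A}
    {H : Matrix (Fin n) (Fin m) A} (hψ : Function.Injective ψ.vecMulLinear)
    (hψH : Function.Exact ψ.vecMulLinear H.vecMulLinear) :
    maximalMinorsIdeal ψ.transpose = ⊤ := by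
  have hex : Function.Exact ψ.vecMulLinear H.vecMulLinear.rangeRestrict := fun x =>
    (Subtype.ext_iff (a1 := H.vecMulLinear.rangeRestrict x) (a2 := 0)).trans (hψH x)
  obtain ⟨l, hl⟩ : ∃ l, l ∘ₗ ψ.vecMulLinear = LinearMap.id := by
    have := (Function.Exact.split_tfae hex hψ (LinearMap.surjective_rangeRestrict _)).out 0 1
    exact this.1 (Module.projective_lifting_property _ _ (LinearMap.surjective_rangeRestrict _))
  have hpres : IsFinitePresentation ψ.transpose (0 : (Fin s → A) →ₗ[A] PUnit.{1}) := by
    refine ⟨fun z => ⟨fun _ => ?_, fun _ => rfl⟩, fun _ => ⟨0, rfl⟩⟩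
    refine ⟨fun j => ∑ i, z i * l (Pi.single j 1) i, ?_⟩
    have hrow : ∀ i, l (ψ i) = Pi.single i 1 := fun i => by
      have := LinearMap.congr_fun hl (Pi.single i 1)
      simpa [Matrix.row] using this
    have hrow' : ∀ i k, ∑ j, ψ i j * l (Pi.single j 1) k = (Pi.single i 1 : Fin s → A) k := by
      intro i k
      rw [← hrow i]
      conv_rhs => rw [pi_eq_sum_univ' (ψ i), map_sum]
      simp only [Finset.sum_apply, map_smul, Pi.smul_apply, smul_eq_mul]
    ext i
    simp only [Matrix.vecMulLinear_apply, Matrix.vecMul_transpose, Matrix.mulVec, dotProduct,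
      Finset.mul_sum, mul_left_comm (ψ i _)]
    rw [Finset.sum_comm]
    simp only [← Finset.mul_sum, hrow']
    simp [Pi.single_apply]
  have := det_mem_maximalMinorsIdeal hpres 1 fun _ => rfl
  rwa [Matrix.det_one, ← Ideal.eq_top_iff_one] at this

theorem isLocalizedModule_map_vecMulLinear {A : Type*} [CommRing A] (S : Submonoid A)
    (B : Type*) [CommRing B] [Algebra A B] [IsLocalization S B]
    {a b : ℕ} (H : Matrix (Fin a) (Fin b) A) :
    IsLocalizedModule.map S (LinearMap.pi fun i : Fin a => Algebra.linearMap A B ∘ₗ .proj i)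
      (LinearMap.pi fun i : Fin b => Algebra.linearMap A B ∘ₗ .proj i) H.vecMulLinear =
      (H.map (algebraMap A B)).vecMulLinear.restrictScalars A := by
  refine IsLocalizedModule.linearMap_ext S
    (LinearMap.pi fun i : Fin a => Algebra.linearMap A B ∘ₗ .proj i)
    (LinearMap.pi fun i : Fin b => Algebra.linearMap A B ∘ₗ .proj i) (LinearMap.ext fun x => ?_)
  rw [LinearMap.comp_apply, IsLocalizedModule.map_apply]
  ext j
  simp [Matrix.vecMul, dotProduct]

theorem exact_vecMulLinear_map_of_isLocalization {A : Type*} [CommRing A] (S : Submonoid A)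
    (B : Type*) [CommRing B] [Algebra A B] [IsLocalization S B]
    {a b c : ℕ} {H : Matrix (Fin a) (Fin b) A}
    {K : Matrix (Fin b) (Fin c) A} (h : Function.Exact H.vecMulLinear K.vecMulLinear) :
    Function.Exact (H.map (algebraMap A B)).vecMulLinear (K.map (algebraMap A B)).vecMulLinear := by
  have := IsLocalizedModule.map_exact S
    (LinearMap.pi fun i : Fin a => Algebra.linearMap A B ∘ₗ .proj i)
    (LinearMap.pi fun i : Fin b => Algebra.linearMap A B ∘ₗ .proj i)
    (LinearMap.pi fun i : Fin c => Algebra.linearMap A B ∘ₗ .proj i) _ _ h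
  rwa [isLocalizedModule_map_vecMulLinear, isLocalizedModule_map_vecMulLinear] at this

theorem injective_vecMulLinear_map_of_isLocalization {A : Type*} [CommRing A] (S : Submonoid A)
    (B : Type*) [CommRing B] [Algebra A B] [IsLocalization S B]
    {a b : ℕ} {H : Matrix (Fin a) (Fin b) A}
    (h : Function.Injective H.vecMulLinear) :
    Function.Injective (H.map (algebraMap A B)).vecMulLinear := by
  have := IsLocalizedModule.map_injective S
    (LinearMap.pi fun i : Fin a => Algebra.linearMap A B ∘ₗ .proj i)
    (LinearMap.pi fun i : Fin b => Algebra.linearMap A B ∘ₗ .proj i) _ h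
  rwa [isLocalizedModule_map_vecMulLinear] at this

theorem exists_isFinitePresentation_of_isLocalization {A : Type*} [CommRing A] (S : Submonoid A)
    (B : Type*) [CommRing B] [Algebra A B] [IsLocalization S B]
    {M N : Type*} [AddCommGroup M] [Module A M]
    [AddCommGroup N] [Module A N] [Module B N] [IsScalarTower A B N] (g : M →ₗ[A] N)
    [IsLocalizedModule S g] {a b : ℕ} {H : Matrix (Fin a) (Fin b) A} {π : (Fin b → A) →ₗ[A] M}
    (h : IsFinitePresentation H π) :
    ∃ ρ : (Fin b → B) →ₗ[B] N, IsFinitePresentation (H.map (algebraMap A B)) ρ := by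
  refine ⟨(IsLocalizedModule.map S
    (LinearMap.pi fun i : Fin b => Algebra.linearMap A B ∘ₗ .proj i) g
    π).extendScalarsOfIsLocalization S B, ?_, ?_⟩
  · have := IsLocalizedModule.map_exact S
      (LinearMap.pi fun i : Fin a => Algebra.linearMap A B ∘ₗ .proj i)
      (LinearMap.pi fun i : Fin b => Algebra.linearMap A B ∘ₗ .proj i) g _ _ h.1
    rwa [isLocalizedModule_map_vecMulLinear] at this
  · exact IsLocalizedModule.map_surjective S _ _ π h.2

open IsLocalRing in
/-- If the localization at a prime is a domain with principal ideals, the Fitting ideal of a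
finitely generated torsion module localizes to the power given by the length. -/
theorem map_fittingIdeal_eq_pow_length {A : Type u} [CommRing A] (p : Ideal A) [p.IsPrime]
    [IsDomain (Localization.AtPrime p)] [IsPrincipalIdealRing (Localization.AtPrime p)]
    {M : Type v} [AddCommGroup M] [Module A M] (d : A)
    (hd : algebraMap A (Localization.AtPrime p) d ≠ 0)
    (hdM : ∀ x : M, d • x = 0) {a b : ℕ} {H : Matrix (Fin a) (Fin b) A}
    {π : (Fin b → A) →ₗ[A] M} (h : IsFinitePresentation H π) :
    (maximalMinorsIdeal H).map (algebraMap A (Localization.AtPrime p)) =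
      p.map (algebraMap A (Localization.AtPrime p)) ^
        (Module.length (Localization.AtPrime p) (LocalizedModule p.primeCompl M)).toNat := by
  obtain ⟨ρ, hρ⟩ := exists_isFinitePresentation_of_isLocalization p.primeCompl
    (Localization.AtPrime p) (LocalizedModule.mkLinearMap p.primeCompl M) h
  have : Module.Finite (Localization.AtPrime p) (LocalizedModule p.primeCompl M) :=
    Module.Finite.of_surjective ρ hρ.2
  rw [Localization.AtPrime.map_eq_maximalIdeal, ← fittingIdeal_eq_maximalIdeal_pow_length,
    fittingIdeal_eq_maximalMinorsIdeal hρ, maximalMinorsIdeal_map]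
  intro x
  refine ⟨⟨_, mem_nonZeroDivisors_of_ne_zero hd⟩, ?_⟩
  induction x using LocalizedModule.induction_on with
  | h m s =>
    change algebraMap A (Localization.AtPrime p) d • LocalizedModule.mk m s = 0
    rw [algebraMap_smul, LocalizedModule.smul'_mk, hdM, LocalizedModule.zero_mk]

/-! ### Ideal identities checked in height one. -/

/-- In a factorial domain divisibility may be checked locally at the prime elements. -/
theorem UniqueFactorizationMonoid.dvd_of_forall_prime_exists_dvd_mul {A : Type*} [CommRing A]
    [IsDomain A] [UniqueFactorizationMonoid A] {a b : A} (ha : a ≠ 0)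
    (h : ∀ π : A, Prime π → ∃ s, ¬ π ∣ s ∧ a ∣ b * s) : a ∣ b := by
  obtain ⟨a', b', g, hrel, rfl, rfl⟩ := exists_reduced_factors a ha b
  have hg : g ≠ 0 := left_ne_zero_of_mul ha
  by_cases hu : IsUnit a'
  · exact mul_dvd_mul_left g (hu.dvd)
  -- After cancelling the common factor `g`, a prime factor `π` of `a'` would divide `b' * s` but
  -- not `s`, contradicting coprimality of `a'` and `b'`.
  obtain ⟨π, hπ, hπa⟩ := WfDvdMonoid.exists_irreducible_factor hu (right_ne_zero_of_mul ha)
  obtain ⟨s, hs, hdvd⟩ := h π hπ.prime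
  rw [mul_assoc] at hdvd
  have h1 : π ∣ b' * s := hπa.trans ((mul_dvd_mul_iff_left hg).1 hdvd)
  exact absurd (hrel hπa ((hπ.prime.dvd_or_dvd h1).resolve_right hs)) hπ.not_isUnit

theorem IsLocalization.exists_dvd_mul_of_algebraMap_dvd {A B : Type*} [CommRing A] [CommRing B]
    [Algebra A B] (S : Submonoid A) [IsLocalization S B]
    {a b : A}
    (h : algebraMap A B a ∣ algebraMap A B b) : ∃ s ∈ S, a ∣ b * s := by
  obtain ⟨z, hz⟩ := h
  obtain ⟨r, s, rfl⟩ := IsLocalization.exists_mk'_eq S z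
  have h1 : algebraMap A B (b * s) = algebraMap A B (a * r) := by
    rw [map_mul, hz, mul_assoc, IsLocalization.mk'_spec, map_mul]
  obtain ⟨t, ht⟩ := (IsLocalization.eq_iff_exists S B).1 h1
  exact ⟨t * s, mul_mem t.2 s.2, t * r, by linear_combination ht⟩

/-- Localizing twice is localizing once at the contracted prime. This carries height-one data on `R`
to the factorial domains `R_P`. -/
theorem Ideal.map_map_localization_atPrime {R A : Type*} [CommRing R] [CommRing A] [Algebra R A]
    (S : Submonoid R) [IsLocalization S A] (q : Ideal A) [q.IsPrime] :
    ∃ e : Localization.AtPrime (q.under R) ≃+* Localization.AtPrime q, ∀ L : Ideal R,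
      (L.map (algebraMap R A)).map (algebraMap A (Localization.AtPrime q)) =
        (L.map (algebraMap R (Localization.AtPrime (q.under R)))).map (e : _ →+* _) := by
  have : IsLocalization.AtPrime (Localization.AtPrime q) (q.under R) :=
    IsLocalization.isLocalization_isLocalization_atPrime_isLocalization S _ q
  let e : Localization.AtPrime (q.under R) ≃ₐ[R] Localization.AtPrime q :=
    IsLocalization.algEquiv (q.under R).primeCompl _ _
  refine ⟨e, fun L => ?_⟩
  rw [map_map, map_map, ← IsScalarTower.algebraMap_eq]
  congr 1
  ext x
  exact (e.commutes x).symm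

open IsLocalRing in
theorem isPrincipalIdealRing_localization_of_isPrincipal {A : Type*} [CommRing A] [IsDomain A]
    [IsNoetherianRing A] (q : Ideal A) [q.IsPrime] (hq : q.IsPrincipal) :
    IsPrincipalIdealRing (Localization.AtPrime q) := by
  obtain ⟨π, hπ⟩ := hq
  refine ((tfae_of_isNoetherianRing_of_isLocalRing_of_isDomain (Localization.AtPrime q)).out 4 0).1
    (⟨⟨algebraMap A _ π, ?_⟩⟩ : (maximalIdeal (Localization.AtPrime q)).IsPrincipal)
  rw [← Localization.AtPrime.map_eq_maximalIdeal]
  have := congrArg (Ideal.map (algebraMap A (Localization.AtPrime q))) hπ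
  rwa [Ideal.submodule_span_eq, Ideal.map_span, Set.image_singleton] at this

/-- The localization at a height one prime of a ring that is locally regular of dimension two is a
domain with principal ideals. -/
theorem isPrincipalIdealRing_localization_of_height_eq_one {R : Type u} [CommRing R]
    (hreg : ∀ (P : Ideal R) [P.IsMaximal], IsRegularLocalRing (Localization.AtPrime P) ∧
      ringKrullDim (Localization.AtPrime P) = 2) (p : Ideal R) [hp : p.IsPrime]
    (hp1 : p.height = 1) :
    IsDomain (Localization.AtPrime p) ∧ IsPrincipalIdealRing (Localization.AtPrime p) := by
  obtain ⟨P, hP, hpP⟩ := p.exists_le_maximal hp.ne_top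
  obtain ⟨hregP, hdimP⟩ := hreg P
  have := IsRegularLocalRing.isDomain_of_ringKrullDim_eq_two _ hdimP
  have := IsRegularLocalRing.uniqueFactorizationMonoid_of_ringKrullDim_eq_two _ hdimP
  have hdisj : Disjoint (P.primeCompl : Set R) p :=
    Set.disjoint_left.2 fun x hx hxp => hx (hpP hxp)
  obtain ⟨q, hq, rfl⟩ : ∃ (q : Ideal (Localization.AtPrime P)), q.IsPrime ∧ q.under R = p :=
    ⟨_, IsLocalization.isPrime_of_isPrime_disjoint P.primeCompl _ _ hp hdisj,
      IsLocalization.under_map_of_isPrime_disjoint P.primeCompl _ hp hdisj⟩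
  have hq1 : q.height = 1 := (IsLocalization.height_under P.primeCompl q).symm.trans hp1
  have := isPrincipalIdealRing_localization_of_isPrincipal q
    (UniqueFactorizationMonoid.isPrincipal_of_height_eq_one hq1)
  obtain ⟨e, -⟩ := Ideal.map_map_localization_atPrime P.primeCompl q
  exact ⟨e.toMulEquiv.isDomain _,
    IsPrincipalIdealRing.of_surjective e.symm.toRingHom e.symm.surjective⟩

/-- Over a factorial domain, an identity `J = b * I` of ideals with `I` of height at least two may
be checked at the height one primes once `J` and `I` become equal after multiplication by nonzero
elements. -/
theorem Ideal.eq_span_singleton_mul_of_forall_height_eq_one {A : Type*} [CommRing A] [IsDomain A]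
    [IsNoetherianRing A] [UniqueFactorizationMonoid A] {I J : Ideal A} {β δ b : A} (hβ : β ≠ 0)
    (hδ : δ ≠ 0) (hb : b ≠ 0) (h : span {β} * J = span {δ} * I)
    (hI : ∀ (q : Ideal A) [q.IsPrime], q.height = 1 →
      I.map (algebraMap A (Localization.AtPrime q)) = ⊤)
    (hJ : ∀ (q : Ideal A) [q.IsPrime], q.height = 1 →
      J.map (algebraMap A (Localization.AtPrime q)) =
        (span {b}).map (algebraMap A (Localization.AtPrime q))) : J = span {b} * I := by
  -- In height one, `I` becomes the unit ideal and `J` becomes `(b)`, so the given relation reads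
  -- `(δ) = (β b)`. Factoriality then makes `δ` and `β b` associated globally.
  have hloc : ∀ (q : Ideal A) [q.IsPrime], q.height = 1 →
      span {algebraMap A (Localization.AtPrime q) δ} =
        span {algebraMap A (Localization.AtPrime q) (β * b)} := by
    intro q _ hq
    have h3 := congrArg (map (algebraMap A (Localization.AtPrime q))) h
    rw [Ideal.map_mul, Ideal.map_mul, hI q hq, hJ q hq, mul_top, map_span, map_span, map_span,
      Set.image_singleton, Set.image_singleton, Set.image_singleton,
      span_singleton_mul_span_singleton, ← _root_.map_mul] at h3
    exact h3.symm
  have hdvd : ∀ x y : A, x ≠ 0 → (∀ (q : Ideal A) [q.IsPrime], q.height = 1 →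
      span {algebraMap A (Localization.AtPrime q) x} =
        span {algebraMap A (Localization.AtPrime q) y}) → x ∣ y := by
    intro x y hx hxy
    refine UniqueFactorizationMonoid.dvd_of_forall_prime_exists_dvd_mul hx fun π hπ => ?_
    have hq : (span {π}).IsPrime := (span_singleton_prime hπ.ne_zero).2 hπ
    have hspan := hxy (span {π}) (height_span_singleton_eq_one_of_mem_nonZeroDivisors
      (mem_nonZeroDivisors_of_ne_zero hπ.ne_zero) hπ.not_isUnit)
    obtain ⟨s, hs, hdvd⟩ := IsLocalization.exists_dvd_mul_of_algebraMap_dvd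
      (span {π}).primeCompl (span_singleton_le_span_singleton.1 hspan.ge)
    exact ⟨s, fun h => hs (mem_span_singleton.2 h), hdvd⟩
  have hassoc : Associated δ (β * b) :=
    associated_of_dvd_dvd (hdvd _ _ hδ fun q _ => hloc q)
      (hdvd _ _ (mul_ne_zero hβ hb) fun q _ hq => (hloc q hq).symm)
  rw [span_singleton_eq_span_singleton.2 hassoc, ← span_singleton_mul_span_singleton,
    mul_assoc] at h
  exact (span_singleton_mul_right_inj hβ).1 h

/-- Over a ring that is locally regular of dimension two, an identity `J = c * I` of ideals, with
`c` locally principal and `I` of height at least two, may be checked at the height one primes once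
`J` and `I` become equal after multiplication by nonzero elements. -/
theorem eq_mul_of_forall_height_eq_one {R : Type u} [CommRing R]
    (hreg : ∀ (P : Ideal R) [P.IsMaximal], IsRegularLocalRing (Localization.AtPrime P) ∧
      ringKrullDim (Localization.AtPrime P) = 2) {I J c : Ideal R} {β δ : R}
    (h : Ideal.span {β} * J = Ideal.span {δ} * I)
    (hβ : ∀ (P : Ideal R) [P.IsMaximal], algebraMap R (Localization.AtPrime P) β ≠ 0)
    (hδ : ∀ (P : Ideal R) [P.IsMaximal], algebraMap R (Localization.AtPrime P) δ ≠ 0)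
    (hI : ∀ (p : Ideal R) [p.IsPrime], p.height = 1 →
      I.map (algebraMap R (Localization.AtPrime p)) = ⊤)
    (hJ : ∀ (p : Ideal R) [p.IsPrime], p.height = 1 →
      J.map (algebraMap R (Localization.AtPrime p)) = c.map (algebraMap R (Localization.AtPrime p)))
    (hc : ∀ (P : Ideal R) [P.IsMaximal], ∃ b ≠ 0,
      c.map (algebraMap R (Localization.AtPrime P)) = Ideal.span {b}) : J = c * I := by
  refine Ideal.eq_of_localization_maximal fun P hP => ?_
  obtain ⟨hregP, hdimP⟩ := hreg P
  obtain ⟨b, hb0, hb⟩ := hc P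
  have := IsRegularLocalRing.isDomain_of_ringKrullDim_eq_two _ hdimP
  have := IsRegularLocalRing.uniqueFactorizationMonoid_of_ringKrullDim_eq_two _ hdimP
  rw [Ideal.map_mul, hb]
  refine Ideal.eq_span_singleton_mul_of_forall_height_eq_one (hβ P) (hδ P) hb0 ?_ ?_ ?_
  · have := congrArg (Ideal.map (algebraMap R (Localization.AtPrime P))) h
    rwa [Ideal.map_mul, Ideal.map_mul, Ideal.map_span, Ideal.map_span, Set.image_singleton,
      Set.image_singleton] at this
  · intro q _ hq
    obtain ⟨e, he⟩ := Ideal.map_map_localization_atPrime P.primeCompl q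
    rw [he, hI _ ((IsLocalization.height_under P.primeCompl q).trans hq), Ideal.map_top]
  · intro q _ hq
    obtain ⟨e, he⟩ := Ideal.map_map_localization_atPrime P.primeCompl q
    rw [← hb, he, he, hJ _ ((IsLocalization.height_under P.primeCompl q).trans hq)]

/-! ### Localization of the characteristic ideal. -/

/-- The ideal `(d)` has height at least one, so such primes are minimal over it. This makes the
product defining the characteristic ideal finite. -/
theorem IsNoetherianRing.finite_height_eq_one_of_mem {R : Type u} [CommRing R] [IsNoetherianRing R]
    {d : R} (hd : d ∈ nonZeroDivisors R) :
    {p : PrimeSpectrum R | p.asIdeal.height = 1 ∧ d ∈ p.asIdeal}.Finite := by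
  refine ((Ideal.finite_minimalPrimes_of_isNoetherianRing R (Ideal.span {d})).preimage
    (f := PrimeSpectrum.asIdeal) fun p _ q _ h => PrimeSpectrum.ext h).subset ?_
  rintro p ⟨hp, hdp⟩
  refine Ideal.mem_minimalPrimes_of_height_le
    ((Ideal.span_singleton_le_iff_mem _).2 hdp) ?_
  rw [hp]
  exact Ideal.one_le_height_span_singleton_of_mem_nonZeroDivisors hd

theorem toNat_length_localizedModule_eq_zero {R : Type u} [CommRing R] {M : Type v}
    [AddCommGroup M] [Module R M] {d : R} (hdM : ∀ x : M, d • x = 0) (p : Ideal R) [p.IsPrime]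
    (hdp : d ∉ p) :
    (Module.length (Localization.AtPrime p) (LocalizedModule p.primeCompl M)).toNat = 0 := by
  have : Subsingleton (LocalizedModule p.primeCompl M) :=
    LocalizedModule.subsingleton_iff.2 fun m => ⟨d, hdp, hdM m⟩
  rw [Module.length_eq_zero, ENat.toNat_zero]

theorem map_characteristicIdeal {R S : Type*} [CommRing R] [CommRing S] [IsNoetherianRing R]
    {M : Type*} [AddCommGroup M] [Module R M] {d : R} (hd : d ∈ nonZeroDivisors R)
    (hdM : ∀ x : M, d • x = 0) (f : R →+* S) :
    (characteristicIdeal R M).map f = ∏ᶠ p : {p : PrimeSpectrum R // p.asIdeal.height = 1},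
      p.1.asIdeal.map f ^ (Module.length (Localization.AtPrime p.1.asIdeal)
        (LocalizedModule p.1.asIdeal.primeCompl M)).toNat := by
  rw [characteristicIdeal]
  refine ((Ideal.mapHom f).toMonoidHom.map_finprod ?_).trans ?_
  · refine Set.Finite.subset ((IsNoetherianRing.finite_height_eq_one_of_mem hd).preimage
      (f := Subtype.val) Subtype.val_injective.injOn) fun p hp => ⟨p.2, ?_⟩
    by_contra hdp
    refine hp ?_
    simp only [toNat_length_localizedModule_eq_zero hdM p.1.asIdeal hdp, pow_zero]
  · refine finprod_congr fun p => ?_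
    exact Ideal.map_pow _ _ _

/-- Distinct primes of height one are incomparable, so every factor other than that of `p` becomes
the unit ideal. -/
theorem map_characteristicIdeal_of_height_eq_one {R : Type u} [CommRing R] [IsNoetherianRing R]
    {M : Type v} [AddCommGroup M] [Module R M] {d : R} (hd : d ∈ nonZeroDivisors R)
    (hdM : ∀ x : M, d • x = 0) (p : Ideal R) [hp : p.IsPrime] (hp1 : p.height = 1) :
    (characteristicIdeal R M).map (algebraMap R (Localization.AtPrime p)) =
      p.map (algebraMap R (Localization.AtPrime p)) ^
        (Module.length (Localization.AtPrime p) (LocalizedModule p.primeCompl M)).toNat := by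
  rw [map_characteristicIdeal hd hdM,
    finprod_eq_single _ (⟨⟨p, hp⟩, hp1⟩ : {p : PrimeSpectrum R // p.asIdeal.height = 1})]
  rintro ⟨⟨p', hp'⟩, hp'1⟩ hne
  have hle : ¬ p' ≤ p := fun hle => by
    rcases hle.eq_or_lt with rfl | hlt
    · exact hne rfl
    · have : p'.FiniteHeight := ⟨Or.inr (by rw [show p'.height = 1 from hp'1]; simp)⟩
      have := Ideal.height_strict_mono_of_isPrime hlt
      rw [hp1, show p'.height = 1 from hp'1] at this
      exact lt_irrefl _ this
  change Ideal.map _ p' ^ _ = 1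
  rw [IsLocalization.AtPrime.map_eq_top_of_not_le _ hle, ← Ideal.one_eq_top, one_pow]

/-- Height-one primes inside `P` extend to height-one, hence principal, primes of the factorial
ring; the others extend to the unit ideal. -/
theorem exists_map_characteristicIdeal_eq_span_singleton {R : Type u} [CommRing R]
    [IsNoetherianRing R] {M : Type v} [AddCommGroup M] [Module R M] {d : R}
    (hd : d ∈ nonZeroDivisors R) (hdM : ∀ x : M, d • x = 0) (P : Ideal R) [P.IsPrime]
    [IsDomain (Localization.AtPrime P)] [UniqueFactorizationMonoid (Localization.AtPrime P)] :
    ∃ b ≠ 0, (characteristicIdeal R M).map (algebraMap R (Localization.AtPrime P)) =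
      Ideal.span {b} := by
  rw [map_characteristicIdeal hd hdM]
  refine finprod_induction (fun L : Ideal (Localization.AtPrime P) => ∃ b ≠ 0, L = Ideal.span {b})
    ⟨1, one_ne_zero, by simp⟩ ?_ ?_
  · rintro _ _ ⟨a, ha, rfl⟩ ⟨b, hb, rfl⟩
    exact ⟨a * b, mul_ne_zero ha hb, Ideal.span_singleton_mul_span_singleton _ _⟩
  · rintro ⟨⟨p, hp⟩, hp1⟩
    change ∃ b ≠ 0, Ideal.map _ p ^ _ = _
    change p.height = 1 at hp1
    by_cases hle : p ≤ P
    · have hdisj : Disjoint (P.primeCompl : Set R) p :=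
        Set.disjoint_left.2 fun x hx hxp => hx (hle hxp)
      have hq := IsLocalization.isPrime_of_isPrime_disjoint P.primeCompl
        (Localization.AtPrime P) _ hp hdisj
      have hq1 : (p.map (algebraMap R (Localization.AtPrime P))).height = 1 := by
        rw [← IsLocalization.height_under P.primeCompl,
          IsLocalization.under_map_of_isPrime_disjoint P.primeCompl _ hp hdisj, hp1]
      obtain ⟨π, hπ⟩ := UniqueFactorizationMonoid.isPrincipal_of_height_eq_one hq1
      rw [Ideal.submodule_span_eq] at hπ
      refine ⟨π ^ _, pow_ne_zero _ ?_, by rw [hπ, Ideal.span_singleton_pow]⟩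
      rintro rfl
      rw [hπ, Ideal.span_singleton_zero] at hq1
      simp at hq1
    · exact ⟨1, one_ne_zero, by
        rw [IsLocalization.AtPrime.map_eq_top_of_not_le _ hle, ← Ideal.one_eq_top, one_pow,
          Ideal.span_singleton_one, Ideal.one_eq_top]⟩

/-! ### Local structure of the ring: regularity and dimension. -/

/-- Each maximal ideal is pulled back from one factor, and that factor is the localization away from
its idempotent, so it is already the local ring there. -/
theorem IsProductOfRegularLocalRings.exists_isRegularLocalRing_localization {R : Type u}
    [CommRing R] (h : IsProductOfRegularLocalRings R) :
    IsNoetherianRing R ∧ Finite (MaximalSpectrum R) ∧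
      ∀ (P : Ideal R) [P.IsMaximal], IsRegularLocalRing (Localization.AtPrime P) := by
  obtain ⟨ι, _, B, _, hB, ⟨e⟩⟩ := h
  classical
  have hnoeth : IsNoetherianRing R := isNoetherianRing_of_ringEquiv (∀ i, B i) e.symm
  let f : (i : ι) → R →+* B i := fun i => (Pi.evalRingHom B i).comp e.toRingHom
  have hf : ∀ i, Function.Surjective (f i) := fun i =>
    (Function.surjective_eval i).comp e.surjective
  have hmax : ∀ P : Ideal R, P.IsMaximal →
      ∃ i, (IsLocalRing.maximalIdeal (B i)).comap (f i) = P := by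
    intro P hP
    obtain ⟨i, q, hq⟩ := PrimeSpectrum.exists_comap_evalRingHom_eq
      (⟨P.comap e.symm.toRingHom, inferInstance⟩ : PrimeSpectrum (∀ i, B i))
    refine ⟨i, (hP.eq_of_le (Ideal.comap_isMaximal_of_surjective (f i) (hf i)).ne_top
      fun x hx => ?_).symm⟩
    refine IsLocalRing.le_maximalIdeal q.2.ne_top ?_
    have : e x ∈ P.comap e.symm.toRingHom := by simpa using hx
    have hq' : q.asIdeal.comap (Pi.evalRingHom B i) = P.comap e.symm.toRingHom :=
      congrArg PrimeSpectrum.asIdeal hq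
    rwa [← hq'] at this
  refine ⟨hnoeth, ?_, fun P hP => ?_⟩
  · refine Finite.of_surjective (fun i => (⟨(IsLocalRing.maximalIdeal (B i)).comap (f i),
      Ideal.comap_isMaximal_of_surjective (f i) (hf i)⟩ :
      MaximalSpectrum R)) fun P => ?_
    obtain ⟨i, hi⟩ := hmax P.1 P.2
    exact ⟨i, MaximalSpectrum.ext hi⟩
  · obtain ⟨i, rfl⟩ := hmax P hP
    let := (f i).toAlgebra
    have : IsLocalization.Away (e.symm (Pi.single i 1)) (B i) := by
      refine IsLocalization.away_of_isIdempotentElem_of_mul ?_ (fun x y => ?_) (hf i)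
      · simp [IsIdempotentElem, ← map_mul, ← Pi.single_mul]
      · rw [← e.injective.eq_iff, map_mul, map_mul, e.apply_symm_apply]
        change e x i = e y i ↔ _
        refine ⟨fun h => funext fun j => ?_, fun h => by simpa using congrFun h i⟩
        by_cases hj : j = i
        · subst hj; simp [h]
        · simp [hj]
    have : IsLocalization.AtPrime (B i) (IsLocalRing.maximalIdeal (B i)) :=
      IsLocalization.self fun x hx => by simpa using! hx
    have : IsLocalization.AtPrime (B i) ((IsLocalRing.maximalIdeal (B i)).comap (f i)) :=
      IsLocalization.isLocalization_isLocalization_atPrime_isLocalization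
        (.powers (e.symm (Pi.single i 1))) (B i) (IsLocalRing.maximalIdeal (B i))
    exact IsRegularLocalRing.of_ringEquiv (IsLocalization.algEquiv
      ((IsLocalRing.maximalIdeal (B i)).comap (f i)).primeCompl (B i) _).toRingEquiv

/-- Flatness gives going down, hence height upstairs is height downstairs plus height in the fibre.
The closed fibre is integral over the residue field, so its contribution is zero. -/
theorem height_eq_ringKrullDim_of_isMaximal {Λ : Type v} [CommRing Λ] [IsLocalRing Λ]
    [IsNoetherianRing Λ] {R : Type u} [CommRing R] [Algebra Λ R] [Module.Flat Λ R]
    [Module.Finite Λ R] (P : Ideal R) [P.IsMaximal] : P.height = ringKrullDim Λ := by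
  have : IsNoetherianRing R := IsNoetherianRing.of_finite Λ R
  have hover : P.under Λ = IsLocalRing.maximalIdeal Λ := IsLocalRing.eq_maximalIdeal inferInstance
  have hle : (P.under Λ).map (algebraMap Λ R) ≤ P := Ideal.map_comap_le
  have hzero : Ring.KrullDimLE 0 (R ⧸ (P.under Λ).map (algebraMap Λ R)) := by
    refine Ring.krullDimLE_zero_iff.2 fun Q hQ => ?_
    refine Ideal.isMaximal_of_isIntegral_of_isMaximal_comap (R := Λ) Q ?_
    have hm : IsLocalRing.maximalIdeal Λ ≤
        Q.comap (algebraMap Λ (R ⧸ (P.under Λ).map (algebraMap Λ R))) := by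
      rw [← hover]
      intro x hx
      have : algebraMap Λ (R ⧸ (P.under Λ).map (algebraMap Λ R)) x = 0 :=
        Ideal.Quotient.eq_zero_iff_mem.2 (Ideal.mem_map_of_mem _ hx)
      rw [Ideal.mem_comap, this]
      exact Q.zero_mem
    rw [← (IsLocalRing.maximalIdeal.isMaximal Λ).eq_of_le (Ideal.IsPrime.ne_top inferInstance) hm]
    infer_instance
  have hprime := Ideal.isPrime_map_quotientMk_of_isPrime hle
  have h0 : (P.map (Ideal.Quotient.mk ((P.under Λ).map (algebraMap Λ R)))).height = 0 := by
    have := Ideal.height_le_ringKrullDim_of_isPrime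
      (I := P.map (Ideal.Quotient.mk ((P.under Λ).map (algebraMap Λ R))))
    have := this.trans (Ring.krullDimLE_iff.1 hzero)
    simpa using this
  rw [Ideal.height_eq_height_add_of_liesOver_of_hasGoingDown (P.under Λ) P, h0, add_zero, hover,
    IsLocalRing.maximalIdeal_height_eq_ringKrullDim]

/-! ### Global freeness of the second syzygy module. -/

/-- Multiplication by `d` embeds `G` into the range, which therefore has full rank. -/
theorem LinearMap.finrank_ker_add_finrank_of_smul_mem_range {A F G : Type u} [CommRing A]
    [IsDomain A] [AddCommGroup F] [Module A F] [Module.Finite A F] [AddCommGroup G]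
    [Module A G] [Module.Free A G] [Module.Finite A G] {f : F →ₗ[A] G} {d : A} (hd : d ≠ 0)
    (h : ∀ y, d • y ∈ LinearMap.range f) :
    Module.finrank A (LinearMap.ker f) + Module.finrank A G = Module.finrank A F := by
  have hf := (LinearMap.ker f).finrank_quotient_add_finrank
  rw [f.quotKerEquivRange.finrank_eq] at hf
  suffices Module.finrank A G = Module.finrank A (LinearMap.range f) by omega
  refine le_antisymm ?_ (Submodule.finrank_le _)
  let g : G →ₗ[A] LinearMap.range f := (d • LinearMap.id).codRestrict _ h
  refine LinearMap.finrank_le_finrank_of_injective (f := g) fun x y hxy => ?_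
  exact smul_right_injective G hd (congrArg Subtype.val hxy)

theorem nonempty_linearEquiv_ker_vecMulLinear_map {A : Type*} [CommRing A] (S : Submonoid A)
    {a b : ℕ} (H : Matrix (Fin a) (Fin b) A) :
    Nonempty (LocalizedModule S (LinearMap.ker H.vecMulLinear) ≃ₗ[Localization S]
      LinearMap.ker (H.map (algebraMap A (Localization S))).vecMulLinear) := by
  have h := LinearMap.localized'_ker_eq_ker_localizedMap (Localization S) S
    (LinearMap.pi fun i : Fin a => Algebra.linearMap A (Localization S) ∘ₗ .proj i)
    (LinearMap.pi fun i : Fin b => Algebra.linearMap A (Localization S) ∘ₗ .proj i) H.vecMulLinear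
  rw [isLocalizedModule_map_vecMulLinear] at h
  let e := IsLocalizedModule.iso S ((LinearMap.ker H.vecMulLinear).toLocalized' (Localization S) S
    (LinearMap.pi fun i : Fin a => Algebra.linearMap A (Localization S) ∘ₗ .proj i))
  exact ⟨(e.extendScalarsOfIsLocalization S (Localization S)).trans (LinearEquiv.ofEq _ _ h)⟩

/-- Over a semilocal ring that is locally regular of dimension two, a torsion module presented by
`m` generators and `n` relations has `n - m` independent second syzygies. -/
theorem nonempty_basis_ker_vecMulLinear {R : Type u} [CommRing R] [Nontrivial R]
    [IsNoetherianRing R]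
    [Finite (MaximalSpectrum R)]
    (hreg : ∀ (P : Ideal R) [P.IsMaximal], IsRegularLocalRing (Localization.AtPrime P) ∧
      ringKrullDim (Localization.AtPrime P) = 2) {n m : ℕ} {H : Matrix (Fin n) (Fin m) R}
    {d : R} (hd : ∀ (P : Ideal R) [P.IsMaximal], algebraMap R (Localization.AtPrime P) d ≠ 0)
    {Q : Matrix (Fin m) (Fin n) R} (hQ : Q * H = d • 1) :
    m ≤ n ∧ Nonempty (Module.Basis (Fin (n - m)) R (LinearMap.ker H.vecMulLinear)) := by
  set K := LinearMap.ker H.vecMulLinear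
  have hloc : ∀ (P : Ideal R) [P.IsMaximal],
      Module.Free (Localization.AtPrime P) (LocalizedModule P.primeCompl K) ∧
        Module.finrank (Localization.AtPrime P) (LocalizedModule P.primeCompl K) + m = n := by
    intro P _
    obtain ⟨_, hdim⟩ := hreg P
    have := IsRegularLocalRing.isDomain_of_ringKrullDim_eq_two _ hdim
    obtain ⟨e⟩ := nonempty_linearEquiv_ker_vecMulLinear_map P.primeCompl H
    have := IsRegularLocalRing.free_ker_of_ringKrullDim_eq_two hdim
      (H.map (algebraMap R (Localization.AtPrime P))).vecMulLinear
    refine ⟨Module.Free.of_equiv e.symm, ?_⟩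
    have := LinearMap.finrank_ker_add_finrank_of_smul_mem_range (hd P)
      (f := (H.map (algebraMap R (Localization.AtPrime P))).vecMulLinear) fun y => ?_
    · rw [Module.finrank_fin_fun, Module.finrank_fin_fun] at this
      exact (congrArg (· + m) e.finrank_eq).trans this
    · refine ⟨Matrix.vecMul y (Q.map (algebraMap R (Localization.AtPrime P))), ?_⟩
      rw [Matrix.vecMulLinear_apply, Matrix.vecMul_vecMul, ← Matrix.map_mul, hQ]
      ext j
      simp [Matrix.vecMul, dotProduct, Matrix.one_apply, mul_comm, apply_ite]
  have : Module.Flat R K := Module.flat_of_localized_maximal K fun P _ => by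
    have := (hloc P).1
    have : Module.Flat (Localization.AtPrime P) (LocalizedModule P.primeCompl K) := inferInstance
    exact Module.Flat.trans R (Localization.AtPrime P) _
  refine ⟨?_, ?_⟩
  · obtain ⟨P, _⟩ := Ideal.exists_maximal R
    have := (hloc P).2
    omega
  -- Over a semilocal ring, a finite flat module whose fibres at all maximal ideals have the same
  -- dimension is free. The fibre dimension is the rank at the stalk, computed in `hloc`.
  refine Module.nonempty_basis_of_flat_of_finrank_eq R K (n - m) fun P => ?_
  let := Ideal.Quotient.field P.1
  have hP : PrimeSpectrum.comap (algebraMap R (R ⧸ P.1)) ⊥ = P.toPrimeSpectrum := by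
    ext x
    exact Ideal.Quotient.eq_zero_iff_mem (I := P.1)
  have := Module.rankAtStalk_baseChange (R := R) (M := K) (S := R ⧸ P.1)
    (⊥ : PrimeSpectrum (R ⧸ P.1))
  rw [Module.rankAtStalk_eq_finrank_of_free, hP] at this
  have h2 := (hloc P.1).2
  change Module.finrank _ _ =
    Module.finrank (Localization.AtPrime P.1) (LocalizedModule P.1.primeCompl K) at this
  omega

/-! ### The Fitting ideal formula. -/

theorem propositionA4
    {Λ : Type v} [CommRing Λ] [IsRegularLocalRing Λ]
    {R : Type u} [CommRing R] [Algebra Λ R]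
    -- `R` contains `Λ` and is free of finite rank over it
    (hinj : Function.Injective (algebraMap Λ R)) [Module.Free Λ R] [Module.Finite Λ R]
    -- `Hom_Λ(R, Λ)`, with `(r φ)(x) = φ (r x)`, is isomorphic to `R` as an `R`-module
    (hdual : ∃ e : (R →ₗ[Λ] Λ) ≃+ R,
      ∀ (r : R) (φ : R →ₗ[Λ] Λ), e (φ ∘ₗ LinearMap.mulLeft Λ r) = r * e φ)
    (hdim : ringKrullDim Λ = 2)
    (hR : IsProductOfRegularLocalRings R)
    (M : Type u) [AddCommGroup M] [Module R M] [Module.Finite R M]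
    (htors : Module.IsTorsion R M) :
    fittingIdeal R M = characteristicIdeal R M * fittingIdeal R (extDual R M 2) := by
  obtain ⟨_, _, hreg'⟩ := hR.exists_isRegularLocalRing_localization
  have hreg : ∀ (P : Ideal R) [P.IsMaximal], IsRegularLocalRing (Localization.AtPrime P) ∧
      ringKrullDim (Localization.AtPrime P) = 2 := fun P _ => ⟨hreg' P, by
    rw [IsLocalization.AtPrime.ringKrullDim_eq_height P,
      height_eq_ringKrullDim_of_isMaximal (Λ := Λ), hdim]⟩
  have : Nontrivial R := hinj.nontrivial
  obtain ⟨d, hd, hdM⟩ : ∃ d ∈ nonZeroDivisors R, ∀ x : M, d • x = 0 := by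
    obtain ⟨d, hd, hd'⟩ := Submodule.annihilator_top_inter_nonZeroDivisors htors
    exact ⟨d, hd', fun x => Submodule.mem_annihilator.1 hd x Submodule.mem_top⟩
  have hdP : ∀ (p : Ideal R) [p.IsPrime], algebraMap R (Localization.AtPrime p) d ≠ 0 :=
    fun p _ => nonZeroDivisors.ne_zero
      (IsLocalization.map_nonZeroDivisors_le p.primeCompl _ (Submonoid.mem_map_of_mem _ hd))
  obtain ⟨m, π, hπ⟩ := Module.Finite.exists_fin' R M
  obtain ⟨n, k, hk⟩ := Module.Finite.exists_fin' R (LinearMap.ker π)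
  let h : (Fin n → R) →ₗ[R] (Fin m → R) := (LinearMap.ker π).subtype ∘ₗ k
  let H : Matrix (Fin n) (Fin m) R := LinearMap.toMatrixRight' h
  have hH : H.vecMulLinear = h := LinearMap.toMatrixRight'.symm_apply_apply h
  have hpres : IsFinitePresentation H π := by
    refine ⟨fun x => ?_, hπ⟩
    rw [hH]
    refine ⟨fun hx => ?_, ?_⟩
    · obtain ⟨y, hy⟩ := hk ⟨x, hx⟩
      exact ⟨y, congrArg Subtype.val hy⟩
    · rintro ⟨y, rfl⟩
      exact (k y).2
  -- Since `d` kills `M`, each `d • e_i` is a combination of the rows of `H`; the coefficients form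
  -- `Q`.
  obtain ⟨Q, hQ⟩ : ∃ Q : Matrix (Fin m) (Fin n) R, Q * H = d • 1 := by
    have hd1 : ∀ i : Fin m, ∃ y, H.vecMulLinear y = d • Pi.single i 1 := fun i =>
      (hpres.1 _).1 (by rw [map_smul, hdM])
    choose Q hQ using hd1
    refine ⟨Matrix.of Q, funext fun i => ?_⟩
    rw [Matrix.mul_apply_eq_vecMul]
    exact (hQ i).trans (by ext j; simp [Matrix.one_apply, Pi.single_apply, eq_comm])
  obtain ⟨hmn, ⟨b⟩⟩ := nonempty_basis_ker_vecMulLinear hreg (fun P _ => hdP P) hQ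
  let ψ : Matrix (Fin (n - m)) (Fin n) R := LinearMap.toMatrixRight'
    ((LinearMap.ker H.vecMulLinear).subtype ∘ₗ b.equivFun.symm.toLinearMap)
  have hψv : ψ.vecMulLinear =
      (LinearMap.ker H.vecMulLinear).subtype ∘ₗ b.equivFun.symm.toLinearMap :=
    LinearMap.toMatrixRight'.symm_apply_apply _
  have hψ : Function.Injective ψ.vecMulLinear := by
    rw [hψv]
    exact Subtype.val_injective.comp b.equivFun.symm.injective
  have hψH : Function.Exact ψ.vecMulLinear H.vecMulLinear := by
    rw [LinearMap.exact_iff, hψv, LinearMap.range_comp_of_range_eq_top _ (LinearEquiv.range _),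
      Submodule.range_subtype]
  have hψH0 : ψ * H = 0 := Matrix.ext_of_single_vecMul fun i => by
    rw [← Matrix.vecMul_vecMul, Matrix.vecMul_zero]
    exact (hψH _).2 ⟨_, rfl⟩
  let e : Fin m ⊕ Fin (n - m) ≃ Fin n := finSumFinEquiv.trans (finCongr (by omega))
  obtain ⟨ρ, hρ⟩ := exists_isFinitePresentation_extDual_two hpres hψ hψH
  rw [fittingIdeal_eq_maximalMinorsIdeal hpres, fittingIdeal_eq_maximalMinorsIdeal hρ]
  -- Here `β` is the determinant of `Q` stacked on `ψ`, and `δ = d ^ m`; the remaining goals are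
  -- their nonvanishing at maximal ideals, the two height-one computations, and local principality
  -- of the characteristic ideal.
  refine eq_mul_of_forall_height_eq_one hreg (span_det_mul_maximalMinorsIdeal_eq hQ hψH0 e)
    ?_ ?_ ?_ ?_ ?_
  · intro P _
    have := IsRegularLocalRing.isDomain_of_ringKrullDim_eq_two _ (hreg P).2
    have hψP := injective_vecMulLinear_map_of_isLocalization P.primeCompl
      (Localization.AtPrime P) hψ
    rw [RingHom.map_det, RingHom.mapMatrix_apply, ← Matrix.submatrix_map, Matrix.fromRows_map]
    refine Matrix.det_fromRows_submatrix_ne_zero (hdP P)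
      (H := H.map (algebraMap R (Localization.AtPrime P))) ?_ ?_
      (fun y hy => hψP (hy.trans (map_zero _).symm)) e
    · rw [← Matrix.map_mul, hQ]
      ext i j
      by_cases hij : i = j <;> simp [hij]
    · rw [← Matrix.map_mul, hψH0, Matrix.map_zero _ (map_zero _)]
  · intro P _
    have := IsRegularLocalRing.isDomain_of_ringKrullDim_eq_two _ (hreg P).2
    rw [map_pow]
    exact pow_ne_zero _ (hdP P)
  · intro p _ hp
    obtain ⟨_, _⟩ := isPrincipalIdealRing_localization_of_height_eq_one hreg p hp
    rw [← maximalMinorsIdeal_map, Matrix.transpose_map]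
    exact maximalMinorsIdeal_transpose_eq_top
      (injective_vecMulLinear_map_of_isLocalization p.primeCompl _ hψ)
      (exact_vecMulLinear_map_of_isLocalization p.primeCompl _ hψH)
  · intro p _ hp
    obtain ⟨_, _⟩ := isPrincipalIdealRing_localization_of_height_eq_one hreg p hp
    rw [map_fittingIdeal_eq_pow_length p d (hdP p) hdM hpres,
      map_characteristicIdeal_of_height_eq_one hd hdM p hp]
  · intro P _
    have := IsRegularLocalRing.isDomain_of_ringKrullDim_eq_two _ (hreg P).2
    have := IsRegularLocalRing.uniqueFactorizationMonoid_of_ringKrullDim_eq_two _ (hreg P).2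
    exact exists_map_characteristicIdeal_eq_span_singleton hd hdM P
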